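/- Let $n\ge 1$, $0<\alpha<n$ and $1<p<q<\infty$, and write $p'=\frac{p}{p-1}$, $q'=\frac{q}{q-1}$. A weight is a non-negative (finite-valued) measurable function on $\mathbb R^n$ that is positive on a set of positive Lebesgue measure; for a weight $w$ let $L^r(w)=L^r(\mathbb R^n, w\,dx)$ and $w(E)=\int_E w\,dx$. For a measurable function $f$ put $$M_\alpha f(x)=\sup_{Q\ni x}|Q|^{\frac{\alpha}{n}-1}\int_Q|f(y)|\,dy\in[0,\infty],\qquad I_\alpha f(x)=\int_{\mathbb R^n}\frac{f(y)}{|x-y|^{n-\alpha}}\,dy,$$ where the supremum is over all cubes $Q$ with sides parallel to the coordinate axes that contain $x$. Let $(u,\sigma)$ be a pair of weights, and consider the inequalities $$\text{(1)}\quad \|M_\alpha(f\sigma)\|_{L^q(u)}\le C\,\|f\|_{L^p(\sigma)}\ \text{ for all } f\in L^p(\sigma),$$ $$\text{(2)}\quad \|M_\alpha(gu)\|_{L^{p'}(\sigma)}\le C\,\|g\|_{L^{q'}(u)}\ \text{ for all } g\in L^{q'}(u),$$ where in each case the finite constant $C$ does not depend on the function. (a) If (1) and (2) hold, then $I_\alpha(\cdot\,\sigma):L^p(\sigma)\to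 L^q(u)$: for every $f\in L^p(\sigma)$ the integral defining $I_\alpha(f\sigma)(x)$ converges absolutely for $u\,dx$-almost every $x$, and there is a finite constant $C$ with $$\|I_\alpha(f\sigma)\|_{L^q(u)}\le C\,\|f\|_{L^p(\sigma)}\quad\text{for all } f\in L^p(\sigma).$$ (b) If (2) holds, then $I_\alpha(\cdot\,\sigma):L^p(\sigma)\to L^{q,\infty}(u)$: for every $f\in L^p(\sigma)$ the integral defining $I_\alpha(f\sigma)(x)$ converges absolutely for $u\,dx$-almost every $x$, and there is a finite constant $C$ with $$\sup_{t>0}\,t\;u\big(\{x\in\mathbb R^n:|I_\alpha(f\sigma)(x)|>t\}\big)^{\frac1q}\le C\,\|f\|_{L^p(\sigma)}\quad\text{for all } f\in L^p(\sigma).$$ -/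

import Mathlib

open MeasureTheory
open scoped ENNReal NNReal

noncomputable section

/-- A weight on `ℝⁿ`: a non-negative (Lebesgue) measurable function that is positive on a set of
positive measure. -/
structure IsWeight {n : ℕ} (w : EuclideanSpace ℝ (Fin n) → ℝ) : Prop where
  aemeasurable : AEMeasurable w volume
  nonneg : ∀ x, 0 ≤ w x
  pos : 0 < volume {x | 0 < w x}

/-- The measure `w dx`. -/
def weightMeasure {n : ℕ} (w : EuclideanSpace ℝ (Fin n) → ℝ) :
    Measure (EuclideanSpace ℝ (Fin n)) :=
  volume.withDensity fun x => ENNReal.ofReal (w x)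

/-- The cube with sides parallel to the axes, lower corner `a` and side length `l`. -/
def cube {n : ℕ} (a : EuclideanSpace ℝ (Fin n)) (l : ℝ) : Set (EuclideanSpace ℝ (Fin n)) :=
  {y | ∀ i, a i ≤ y i ∧ y i < a i + l}

/-- The fractional maximal operator
`M_α f (x) = sup_{Q ∋ x} |Q|^(α/n) ⨍_Q |f|`, with values in `[0, ∞]`. -/
def fracMaximal {n : ℕ} (α : ℝ) (f : EuclideanSpace ℝ (Fin n) → ℝ)
    (x : EuclideanSpace ℝ (Fin n)) : ℝ≥0∞ :=
  ⨆ (a : EuclideanSpace ℝ (Fin n)) (l : ℝ) (_ : 0 < l) (_ : x ∈ cube a l),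
    volume (cube a l) ^ (α / n) * ((volume (cube a l))⁻¹ * ∫⁻ y in cube a l, ‖f y‖ₑ)

/-- The integrand `y ↦ f y / |x - y|^(n - α)` of the fractional integral at `x`. -/
def rieszIntegrand {n : ℕ} (α : ℝ) (f : EuclideanSpace ℝ (Fin n) → ℝ)
    (x y : EuclideanSpace ℝ (Fin n)) : ℝ :=
  f y / ‖x - y‖ ^ ((n : ℝ) - α)

/-- The fractional integral operator (Riesz potential) `I_α f (x) = ∫ f y / |x - y|^(n - α) dy`. -/
def fracIntegral {n : ℕ} (α : ℝ) (f : EuclideanSpace ℝ (Fin n) → ℝ)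
    (x : EuclideanSpace ℝ (Fin n)) : ℝ :=
  ∫ y, rieszIntegrand α f x y

/-- `I_α (f σ)` is defined by an absolutely convergent integral at `u`-almost every point,
for every `f ∈ L^p(σ)`. -/
def FracIntegralConverges {n : ℕ} (α p : ℝ) (σ u : EuclideanSpace ℝ (Fin n) → ℝ) : Prop :=
  ∀ f : EuclideanSpace ℝ (Fin n) → ℝ, MemLp f (ENNReal.ofReal p) (weightMeasure σ) →
    ∀ᵐ x ∂(weightMeasure u), Integrable (rieszIntegrand α (fun y => f y * σ y) x) volume

/-- The strong type inequality `T(· σ) : L^p(σ) → L^q(u)`: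
`‖T(f σ)‖_{L^q(u)} ≤ C ‖f‖_{L^p(σ)}` for all `f ∈ L^p(σ)`, with `C` independent of `f`. -/
def StrongType {n : ℕ} {ε : Type} [ENorm ε]
    (T : (EuclideanSpace ℝ (Fin n) → ℝ) → EuclideanSpace ℝ (Fin n) → ε)
    (p q : ℝ) (σ u : EuclideanSpace ℝ (Fin n) → ℝ) : Prop :=
  ∃ C : ℝ≥0, ∀ f : EuclideanSpace ℝ (Fin n) → ℝ,
    MemLp f (ENNReal.ofReal p) (weightMeasure σ) →
      eLpNorm (T fun y => f y * σ y) (ENNReal.ofReal q) (weightMeasure u) ≤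
        C * eLpNorm f (ENNReal.ofReal p) (weightMeasure σ)

/-- The weak type inequality `T(· σ) : L^p(σ) → L^{q,∞}(u)`:
`t u({|T(f σ)| > t})^(1/q) ≤ C ‖f‖_{L^p(σ)}` for all `t > 0` and `f ∈ L^p(σ)`, with `C`
independent of `t` and `f`. -/
def WeakType {n : ℕ} {ε : Type} [ENorm ε]
    (T : (EuclideanSpace ℝ (Fin n) → ℝ) → EuclideanSpace ℝ (Fin n) → ε)
    (p q : ℝ) (σ u : EuclideanSpace ℝ (Fin n) → ℝ) : Prop :=
  ∃ C : ℝ≥0, ∀ f : EuclideanSpace ℝ (Fin n) → ℝ,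
    MemLp f (ENNReal.ofReal p) (weightMeasure σ) → ∀ t : ℝ, 0 < t →
      ENNReal.ofReal t *
          weightMeasure u {x | ENNReal.ofReal t < ‖T (fun y => f y * σ y) x‖ₑ} ^ (1 / q) ≤
        C * eLpNorm f (ENNReal.ofReal p) (weightMeasure σ)

end

open MeasureTheory
open scoped ENNReal NNReal

/-! Since `p < q`, a maximal inequality controls the potential at weak level, and two weak
inequalities, one for each order of the pair, bootstrap to the strong one.

Weak type: testing (2) on indicators of subsets of a ball makes the `L^{p'}(σ)` norm of the kernel
off the ball, times the `1/q` power of the `u`-mass of the ball, bounded uniformly in the ball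
(`exists_global_testing`). Given this, take a point where the averages of `f ^ p σ` with respect to
`u` over centred balls are at most `N`. Cut space into rings between balls whose `u`-masses halve,
and apply Hölder on each ring. The ring bounds decay like `2 ^ (-(1/p - 1/q) j)`, so the potential
is at most a constant times `N^{1/q} ‖f‖^{1 - p/q}` (`lintegral_mul_kernel_le_of_ball_averages_le`).
The points with larger averages are controlled by the centred maximal function, of weak type (1,1)
for any `u` by Besicovitch's covering theorem (`exists_kernel_weak_type`). This is (b).

Strong type: (1) is (2) for the swapped pair with exponents `q' < p'`, so it gives the weak
inequality for the adjoint potential. By duality and Kolmogorov's inequality, each weak inequality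
bounds the opposite potential on indicators of sets (`exists_testing_of_dual_weak_type`). These two
testing conditions suffice. The kernel is dominated by sums over finitely many shifted dyadic grids.
Each resulting bilinear form is split by parallel stopping cubes and summed with the Carleson
embedding and the inclusion of `ℓ^1` in `ℓ^{p'/q'}` (`exists_sum_laminar_le`). -/

/-- Geometric sums over the dyadic scales below `y` are controlled by their largest term. -/
theorem exists_sum_zpow_rpow_le (β : ℝ) (hβ : 0 < β) : ∃ C : ℝ≥0, ∀ (J : Finset ℤ) (y : ℝ≥0∞),
    ∑ j ∈ J with (2 : ℝ≥0∞) ^ j ≤ y, ((2 : ℝ≥0∞) ^ j) ^ β ≤ C * y ^ β := by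
  set r : ℝ≥0∞ := (2 : ℝ≥0∞) ^ (-β) with hr
  have hr1 : r < 1 := ENNReal.rpow_lt_one_of_one_lt_of_neg (by norm_num) (by linarith)
  have hfin : (1 - r)⁻¹ ≠ ∞ := by
    simpa [ENNReal.inv_eq_top, tsub_eq_zero_iff_le] using hr1
  have hpos : (1 - r)⁻¹ ≠ 0 := by
    simp
  refine ⟨(1 - r)⁻¹.toNNReal, fun J y => ?_⟩
  rw [ENNReal.coe_toNNReal hfin]
  rcases eq_or_ne y ∞ with rfl | hy
  · rw [ENNReal.top_rpow_of_pos hβ, ENNReal.mul_top hpos]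
    exact le_top
  rcases eq_or_ne y 0 with rfl | hy0
  · rw [Finset.filter_false_of_mem]
    · simp
    · intro j _ h
      exact (ENNReal.zpow_pos (by norm_num) (by norm_num) j).ne' (le_antisymm h bot_le)
  -- `2 ^ m` is the largest admissible scale; indexing by `m - j` turns the sum into part of a
  -- geometric series of ratio `r`.
  obtain ⟨m, hm1, hm2⟩ := ENNReal.exists_mem_Ico_zpow hy0 hy (y := 2) (by norm_num) (by norm_num)
  have hle : ∀ j ∈ J.filter (fun j => (2 : ℝ≥0∞) ^ j ≤ y), j ≤ m := by
    intro j hj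
    have h1 := (Finset.mem_filter.1 hj).2
    by_contra hlt
    have : (2 : ℝ≥0∞) ^ (m + 1) ≤ 2 ^ j := ENNReal.zpow_le_of_le (by norm_num) (by omega)
    exact absurd (this.trans h1) (not_le.2 hm2)
  calc ∑ j ∈ J with (2 : ℝ≥0∞) ^ j ≤ y, ((2 : ℝ≥0∞) ^ j) ^ β
      = ∑ j ∈ J with (2 : ℝ≥0∞) ^ j ≤ y, ((2 : ℝ≥0∞) ^ m) ^ β * r ^ (m - j).toNat := by
        refine Finset.sum_congr rfl fun j hj => ?_
        have hjm := hle j hj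
        rw [← ENNReal.rpow_intCast, ← ENNReal.rpow_intCast, ← ENNReal.rpow_natCast, hr,
          ← ENNReal.rpow_mul, ← ENNReal.rpow_mul, ← ENNReal.rpow_mul,
          ← ENNReal.rpow_add _ _ (by norm_num) (by norm_num)]
        congr 1
        have : (((m - j).toNat : ℕ) : ℝ) = m - j := by
          have : (((m - j).toNat : ℕ) : ℤ) = m - j := Int.toNat_of_nonneg (by omega)
          exact_mod_cast this
        rw [this]; ring
    _ = ((2 : ℝ≥0∞) ^ m) ^ β *
        ∑ i ∈ (J.filter (fun j => (2 : ℝ≥0∞) ^ j ≤ y)).image (fun j => (m - j).toNat), r ^ i := by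
        rw [Finset.sum_image, Finset.mul_sum]
        intro a ha b hb hab
        have h1 := hle a ha
        have h2 := hle b hb
        simp only at hab
        omega
    _ ≤ y ^ β * ∑' i : ℕ, r ^ i := by
        gcongr
        exact ENNReal.sum_le_tsum _
    _ = _ := by rw [ENNReal.tsum_geometric, mul_comm]

/-! ### Converse of Hölder's inequality -/

section Duality
variable {X : Type*} [MeasurableSpace X]

/-- Divide by `I ^ (1 / q)`. The division needs `I` finite, which is why the converse of Hölder
below truncates first. -/
theorem rpow_le_of_le_mul_rpow {I K : ℝ≥0∞} {p q : ℝ} (hpq : p.HolderConjugate q) (hI : I ≠ ∞)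
    (h : I ≤ K * I ^ (1 / q)) : I ^ (1 / p) ≤ K := by
  rcases eq_or_ne I 0 with rfl | h0
  · rw [ENNReal.zero_rpow_of_pos (by have := hpq.pos; positivity)]; exact bot_le
  have hq := hpq.symm.pos
  have h1 : I ^ (1 / q) ≠ 0 := by simp [ENNReal.rpow_eq_zero_iff, h0, hI]
  have h2 : I ^ (1 / q) ≠ ∞ := by
    exact ENNReal.rpow_ne_top_of_nonneg (by positivity) hI
  rw [← ENNReal.mul_le_mul_iff_left h1 h2]
  refine le_trans (le_of_eq ?_) h
  rw [← ENNReal.rpow_add _ _ h0 hI]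
  have : 1 / p + 1 / q = 1 := by simpa [one_div] using hpq.inv_add_inv_eq_one
  rw [this, ENNReal.rpow_one]

/-- Converse of Hölder's inequality. -/
theorem rpow_lintegral_le_of_forall_lintegral_mul_le (μ : Measure X) [SigmaFinite μ] {p q : ℝ}
    (hpq : p.HolderConjugate q) {h : X → ℝ≥0∞} (hh : Measurable h) {K : ℝ≥0∞}
    (H : ∀ g : X → ℝ≥0∞, Measurable g → ∫⁻ x, g x ^ q ∂μ ≠ ∞ →
      ∫⁻ x, h x * g x ∂μ ≤ K * (∫⁻ x, g x ^ q ∂μ) ^ (1 / q)) :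
    (∫⁻ x, h x ^ p ∂μ) ^ (1 / p) ≤ K := by
  have hp := hpq.pos
  -- Truncation in height and to sets of finite measure: the `p`-th power becomes integrable, and
  -- monotone convergence recovers `h`.
  let hk : ℕ → X → ℝ≥0∞ := fun k => (spanningSets μ k).indicator (fun x => min (h x) k)
  have hkm : ∀ k, Measurable (hk k) := fun k =>
    (hh.min measurable_const).indicator (measurableSet_spanningSets μ k)
  have hkle : ∀ k x, hk k x ≤ h x := fun k x => by
    by_cases hx : x ∈ spanningSets μ k
    · simp [hk, hx]
    · simp [hk, hx]
  have hmono : Monotone hk := by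
    intro a b hab x
    by_cases hx : x ∈ spanningSets μ a
    · have hx' := monotone_spanningSets μ hab hx
      simp only [hk, hx, hx', Set.indicator_of_mem]
      have : (a : ℝ≥0∞) ≤ b := by exact_mod_cast hab
      exact min_le_min le_rfl this
    · simp [hk, hx]
  have hsup : ∀ x, ⨆ k, hk k x = h x := by
    intro x
    refine le_antisymm (iSup_le fun k => hkle k x) ?_
    obtain ⟨k0, hk0⟩ : ∃ k, x ∈ spanningSets μ k := by
      have := iUnion_spanningSets μ
      exact Set.mem_iUnion.1 (this ▸ Set.mem_univ x)
    refine le_of_forall_lt fun c hc => ?_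
    obtain ⟨k1, hk1⟩ := ENNReal.exists_nat_gt (ne_top_of_lt hc)
    refine lt_of_lt_of_le ?_ (le_iSup _ (max k0 k1))
    have hx' := monotone_spanningSets μ (le_max_left k0 k1) hk0
    simp only [hk, hx', Set.indicator_of_mem]
    refine lt_min hc (hk1.trans_le ?_)
    exact_mod_cast le_max_right k0 k1
  have hbd : ∀ k, ∫⁻ x, hk k x ^ p ∂μ ≤ K ^ p := by
    intro k
    have hfin : ∫⁻ x, hk k x ^ p ∂μ ≠ ∞ := by
      have : ∫⁻ x, hk k x ^ p ∂μ ≤ ∫⁻ x, (spanningSets μ k).indicator (fun _ => (k : ℝ≥0∞) ^ p) x ∂μ := by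
        refine lintegral_mono fun x => ?_
        by_cases hx : x ∈ spanningSets μ k
        · simp only [hk, hx, Set.indicator_of_mem]
          exact ENNReal.rpow_le_rpow (min_le_right _ _) hp.le
        · simp [hk, hx, hp]
      refine ne_top_of_le_ne_top ?_ this
      rw [lintegral_indicator_const (measurableSet_spanningSets μ k)]
      exact ENNReal.mul_ne_top (ENNReal.rpow_ne_top_of_nonneg hp.le (by simp))
        (measure_spanningSets_lt_top μ k).ne
    -- The extremal test function: since `(p - 1) q = p`, its `q`-th power is `hk k ^ p`.
    have h1 := H (fun x => hk k x ^ (p - 1)) ((hkm k).pow_const _)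
      (by simpa only [← ENNReal.rpow_mul, hpq.sub_one_mul_conj] using hfin)
    have h2 : ∫⁻ x, hk k x ^ p ∂μ ≤ K * (∫⁻ x, hk k x ^ p ∂μ) ^ (1 / q) := by
      calc ∫⁻ x, hk k x ^ p ∂μ ≤ ∫⁻ x, h x * hk k x ^ (p - 1) ∂μ := by
            refine lintegral_mono fun x => ?_
            have : hk k x ^ p = hk k x ^ (1 + (p - 1)) := by ring_nf
            rw [this, ENNReal.rpow_add_of_nonneg _ _ zero_le_one hpq.sub_one_pos.le,
              ENNReal.rpow_one]
            gcongr
            exact hkle k x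
        _ ≤ _ := h1
        _ = _ := by
            simp_rw [← ENNReal.rpow_mul, hpq.sub_one_mul_conj]
    have h3 := rpow_le_of_le_mul_rpow hpq hfin h2
    calc ∫⁻ x, hk k x ^ p ∂μ = ((∫⁻ x, hk k x ^ p ∂μ) ^ (1 / p)) ^ p := by
          rw [← ENNReal.rpow_mul, one_div_mul_cancel hp.ne', ENNReal.rpow_one]
      _ ≤ _ := ENNReal.rpow_le_rpow h3 hp.le
  have : ∫⁻ x, h x ^ p ∂μ ≤ K ^ p := by
    have heq : ∫⁻ x, h x ^ p ∂μ = ⨆ k, ∫⁻ x, hk k x ^ p ∂μ := by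
      rw [← lintegral_iSup (fun k => (hkm k).pow_const _)]
      · refine lintegral_congr fun x => ?_
        rw [← hsup x]
        exact (ENNReal.orderIsoRpow p hp).map_iSup _
      · intro a b hab x
        exact ENNReal.rpow_le_rpow (hmono hab x) hp.le
    rw [heq]
    exact iSup_le hbd
  calc (∫⁻ x, h x ^ p ∂μ) ^ (1 / p) ≤ (K ^ p) ^ (1 / p) :=
        ENNReal.rpow_le_rpow this (by positivity)
    _ = K := by rw [← ENNReal.rpow_mul, mul_one_div_cancel hp.ne', ENNReal.rpow_one]

end Duality

/-! ### Kolmogorov's inequality -/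

section Kolmogorov
variable {X : Type*} [MeasurableSpace X]

/-- A dyadic substitute for the layer-cake formula. If `t * 2 ^ j` is the first level to reach `y`,
then either `j = 0` and `t` suffices, or the term of index `j - 1` already dominates `y`. If no
level does, every term is at least `t` and the sum diverges. -/
theorem le_add_tsum_indicator_dyadic (t y : ℝ≥0∞) (ht0 : t ≠ 0) :
    y ≤ t + ∑' j : ℕ, (if t * 2 ^ j < y then t * 2 ^ (j + 1) else 0) := by
  by_cases hex : ∃ j : ℕ, y ≤ t * 2 ^ j
  · classical
    rcases hj : Nat.find hex with _ | j
    · have := Nat.find_spec hex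
      rw [hj] at this
      exact (by simpa using this : y ≤ t).trans le_self_add
    · have h1 := Nat.find_spec hex
      rw [hj] at h1
      have h2 : t * 2 ^ j < y := not_le.1 (Nat.find_min hex (m := j) (by omega))
      refine le_trans ?_ le_add_self
      refine le_trans ?_ (ENNReal.le_tsum j)
      rw [if_pos h2]; exact h1
  · push Not at hex
    have hy : ∑' j : ℕ, (if t * 2 ^ j < y then t * 2 ^ (j + 1) else 0) = ∞ := by
      have : ∀ j : ℕ, t ≤ (if t * 2 ^ j < y then t * 2 ^ (j + 1) else 0) := by
        intro j
        rw [if_pos (hex j)]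
        exact le_mul_of_one_le_right' (one_le_pow₀ (by norm_num))
      refine top_le_iff.1 (le_trans ?_ (ENNReal.tsum_le_tsum this))
      rw [ENNReal.tsum_const_eq_top_of_ne_zero ht0]
    rw [hy]; simp

/-- Kolmogorov's inequality: a function in weak `L^r` is integrable over sets of finite measure. -/
theorem exists_setLIntegral_le_of_weak (r : ℝ) (hr : 1 < r) : ∃ C : ℝ≥0,
    ∀ (μ : Measure X) (F : Set X), μ F ≠ ∞ → ∀ (h : X → ℝ≥0∞), Measurable h → ∀ W : ℝ≥0∞,
      (∀ t : ℝ≥0∞, t ≠ 0 → t ≠ ∞ → t * μ {x | t < h x} ^ (1 / r) ≤ W) →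
      ∫⁻ x in F, h x ∂μ ≤ C * W * μ F ^ (1 - 1 / r) := by
  set c : ℝ≥0∞ := (2 : ℝ≥0∞) ^ (1 - r) with hc
  have hc1 : c < 1 := ENNReal.rpow_lt_one_of_one_lt_of_neg (by norm_num) (by linarith)
  have hfin : (1 - c)⁻¹ ≠ ∞ := by
    simpa [ENNReal.inv_eq_top, tsub_eq_zero_iff_le] using hc1
  have hr0 : 0 < r := by linarith
  refine ⟨(1 + 2 * (1 - c)⁻¹).toNNReal, fun μ F hF h hh W hW => ?_⟩
  rw [ENNReal.coe_toNNReal (by finiteness)]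
  -- The height `t` stays free: below it `h` is bounded by `t`, above it the weak bound is summed
  -- over the levels `t * 2 ^ j`, which converges because `r > 1`.
  have key : ∀ t : ℝ≥0∞, t ≠ 0 → t ≠ ∞ →
      ∫⁻ x in F, h x ∂μ ≤ t * μ F + 2 * (1 - c)⁻¹ * (t ^ (1 - r) * W ^ r) := by
    intro t ht0 ht
    have hmeas : ∀ j : ℕ, MeasurableSet {x | t * 2 ^ j < h x} := fun j =>
      measurableSet_lt measurable_const hh
    have hmass : ∀ s : ℝ≥0∞, s ≠ 0 → s ≠ ∞ → μ {x | s < h x} ≤ s ^ (-r) * W ^ r := by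
      intro s hs0 hs
      have h1 := ENNReal.rpow_le_rpow (hW s hs0 hs) hr0.le
      rw [ENNReal.mul_rpow_of_nonneg _ _ hr0.le, ← ENNReal.rpow_mul,
        one_div_mul_cancel hr0.ne', ENNReal.rpow_one] at h1
      calc μ {x | s < h x} = s ^ (-r) * (s ^ r * μ {x | s < h x}) := by
            rw [← mul_assoc, ← ENNReal.rpow_add _ _ hs0 hs]; simp
        _ ≤ _ := by gcongr
    calc ∫⁻ x in F, h x ∂μ
        ≤ ∫⁻ x in F, (t + ∑' j : ℕ, (if t * 2 ^ j < h x then t * 2 ^ (j + 1) else 0)) ∂μ :=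
          lintegral_mono fun x => le_add_tsum_indicator_dyadic t (h x) ht0
      _ = t * μ F + ∑' j : ℕ, ∫⁻ x in F, {x | t * 2 ^ j < h x}.indicator
            (fun _ => t * 2 ^ (j + 1)) x ∂μ := by
          rw [lintegral_add_left measurable_const, setLIntegral_const, lintegral_tsum]
          · simp only [Set.indicator_apply, Set.mem_ofPred_eq]
          · exact fun j => (Measurable.ite (hmeas j) measurable_const measurable_const).aemeasurable
      _ ≤ t * μ F + ∑' j : ℕ, (t * 2 ^ (j + 1)) * ((t * 2 ^ j) ^ (-r) * W ^ r) := by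
          gcongr with j
          rw [lintegral_indicator_const (hmeas j)]
          gcongr
          refine (Measure.restrict_apply_le _ _).trans (hmass _ ?_ ?_)
          · exact mul_ne_zero ht0 (by simp)
          · finiteness
      _ = t * μ F + ∑' j : ℕ, (2 * (t ^ (1 - r) * W ^ r)) * c ^ j := by
          congr 2; ext j
          have e1 : (t * 2 ^ j) ^ (-r) = t ^ (-r) * ((2 : ℝ≥0∞) ^ (-r)) ^ j := by
            rw [ENNReal.mul_rpow_of_ne_top ht (by finiteness), ← ENNReal.rpow_natCast,
              ← ENNReal.rpow_natCast, ← ENNReal.rpow_mul, ← ENNReal.rpow_mul, mul_comm (j : ℝ)]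
          have e2 : c = 2 * (2 : ℝ≥0∞) ^ (-r) := by
            rw [hc, sub_eq_add_neg, ENNReal.rpow_add _ _ (by norm_num) (by norm_num),
              ENNReal.rpow_one]
          have e3 : t ^ (1 - r) = t * t ^ (-r) := by
            rw [sub_eq_add_neg, ENNReal.rpow_add _ _ ht0 ht, ENNReal.rpow_one]
          rw [e1, e2, e3, mul_pow, pow_succ]; ring
      _ = _ := by rw [ENNReal.tsum_mul_left, ENNReal.tsum_geometric]; ring
  rcases eq_or_ne (μ F) 0 with h0 | h0
  · rw [setLIntegral_measure_zero _ _ h0]; exact bot_le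
  rcases eq_or_ne W ∞ with rfl | hWt
  · have : (1 + 2 * (1 - c)⁻¹) ≠ 0 := by simp
    rw [ENNReal.mul_top this, ENNReal.top_mul]
    · exact le_top
    · simp [ENNReal.rpow_eq_zero_iff, h0, hF]
  rcases eq_or_ne W 0 with rfl | hW0
  · have : ∫⁻ x in F, h x ∂μ ≤ 0 := by
      refine ENNReal.le_of_forall_pos_le_add fun ε hε _ => ?_
      refine (key (ε / μ F) (ENNReal.div_ne_zero.2 ⟨by simpa using hε.ne', hF⟩)
        (ENNReal.div_ne_top (by simp) h0)).trans ?_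
      rw [ENNReal.zero_rpow_of_pos hr0, ENNReal.div_mul_cancel h0 hF]
      simp
    exact this.trans bot_le
  set m := μ F
  -- This height balances the two terms of `key`: both become multiples of `W * m ^ (1 - 1 / r)`.
  refine (key (W * m ^ (-(1 / r))) (mul_ne_zero hW0 ?_) (ENNReal.mul_ne_top hWt ?_)).trans
    (le_of_eq ?_)
  · simp [ENNReal.rpow_eq_zero_iff, h0, hF]
  · simp [ENNReal.rpow_eq_top_iff, h0, hF]
  have e1 : m ^ (-(1 / r)) * m = m ^ (1 - 1 / r) := by
    conv_lhs => rw [← ENNReal.rpow_one m, ← ENNReal.rpow_mul, ← ENNReal.rpow_add _ _ h0 hF]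
    congr 1; ring
  have e2 : (W * m ^ (-(1 / r))) ^ (1 - r) * W ^ r = W * m ^ (1 - 1 / r) := by
    rw [ENNReal.mul_rpow_of_ne_zero hW0 (by simp [ENNReal.rpow_eq_zero_iff, h0, hF]),
      mul_right_comm, ← ENNReal.rpow_add _ _ hW0 hWt, ← ENNReal.rpow_mul]
    congr 1
    · simp
    · congr 1; field_simp; ring
  rw [mul_assoc, e1, e2]; ring

end Kolmogorov

/-! ### Stopping sets and the two weight testing theorem on laminar families -/

/-- The inclusion of `ℓ^1` in `ℓ^r`. With `r = p' / q'`, this is how the off-diagonal condition `q'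
≤ p'` enters the stopping argument. -/
theorem sum_rpow_le_rpow_sum {κ : Type*} (s : Finset κ) (h : κ → ℝ≥0∞) {r : ℝ} (hr : 1 ≤ r) :
    ∑ i ∈ s, h i ^ r ≤ (∑ i ∈ s, h i) ^ r := by
  classical
  induction s using Finset.induction_on with
  | empty => simp
  | insert a s ha ih =>
    rw [Finset.sum_insert ha, Finset.sum_insert ha]
    exact (add_le_add le_rfl ih).trans (ENNReal.add_rpow_le_rpow_add _ _ hr)

/-- Stopping sets of a finite laminar family: to every member `Q i` belong a level `l i` and the
largest member `F i ⊇ Q i` on which `a` is at least `2 ^ l i`. -/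
theorem exists_stopping {X ι : Type*} [Fintype ι] (Q : ι → Set X)
    (hlam : ∀ i j, Q i ⊆ Q j ∨ Q j ⊆ Q i ∨ Disjoint (Q i) (Q j))
    (a : ι → ℝ≥0∞) (ha0 : ∀ i, a i ≠ 0) (ha : ∀ i, a i ≠ ∞) :
    ∃ (l : ι → ℤ) (F : ι → Set X), (∀ i, Q i ⊆ F i) ∧ (∀ i, a i ≤ 2 ^ (l i + 1)) ∧
      (∀ i, ∃ j, F i = Q j ∧ 2 ^ l i ≤ a j) ∧ (∀ i i', Q i' ⊆ F i → l i ≤ l i') ∧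
      ∀ i i', l i = l i' → F i = F i' ∨ Disjoint (F i) (F i') := by
  -- `m i` carries the largest value of `a` among the members containing `Q i`; the dyadic level of
  -- that value is `l i`.
  have hsup : ∀ i, ∃ j, Q i ⊆ Q j ∧ ∀ k, Q i ⊆ Q k → a k ≤ a j := by
    intro i
    obtain ⟨j, hj, hj'⟩ := (Set.toFinite {j | Q i ⊆ Q j}).exists_maximalFor a _ ⟨i, (subset_rfl : Q i ⊆ Q i)⟩
    refine ⟨j, hj, fun k hk => ?_⟩
    rcases le_total (a k) (a j) with h | h
    · exact h
    · exact hj' hk h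
  choose m hm hm' using hsup
  have hlev : ∀ i, ∃ l : ℤ, a (m i) ∈ Set.Ico ((2 : ℝ≥0∞) ^ l) (2 ^ (l + 1)) := fun i =>
    ENNReal.exists_mem_Ico_zpow (ha0 _) (ha _) (by norm_num) (by norm_num)
  choose l hl using hlev
  have hF : ∀ i, ∃ j, (Q i ⊆ Q j ∧ 2 ^ l i ≤ a j) ∧
      ∀ k, Q i ⊆ Q k → 2 ^ l i ≤ a k → Q j ⊆ Q k → Q k ⊆ Q j := by
    intro i
    obtain ⟨j, hj, hj'⟩ := (Set.toFinite {j | Q i ⊆ Q j ∧ (2 : ℝ≥0∞) ^ l i ≤ a j}).exists_maximalFor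
      Q _ ⟨m i, hm i, (hl i).1⟩
    exact ⟨j, hj, fun k hk hk' hjk => hj' ⟨hk, hk'⟩ hjk⟩
  choose f hf hf' using hF
  refine ⟨l, fun i => Q (f i), fun i => (hf i).1, fun i => ?_, fun i => ⟨f i, rfl, (hf i).2⟩, ?_, ?_⟩
  · exact (hm' i i subset_rfl).trans (hl i).2.le
  · intro i i' hii'
    -- `F i` is itself a member containing `Q i'`, hence competes in the maximum that defines `l
    -- i'`.
    have h1 : (2 : ℝ≥0∞) ^ l i ≤ a (m i') := (hf i).2.trans (hm' i' _ hii')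
    have h2 := h1.trans_lt (hl i').2
    by_contra hlt
    have : (2 : ℝ≥0∞) ^ (l i' + 1) ≤ 2 ^ l i := ENNReal.zpow_le_of_le (by norm_num) (by omega)
    exact absurd h2 (not_lt.2 this)
  · intro i i' hll
    -- At equal levels the larger of two nested stopping sets is a candidate for both indices, so
    -- maximality makes them equal.
    rcases hlam (f i) (f i') with h | h | h
    · left
      exact h.antisymm (hf' i _ ((hf i).1.trans h) (hll ▸ (hf i').2) h)
    · left
      exact (hf' i' _ ((hf i').1.trans h) (hll ▸ (hf i).2) h).antisymm h
    · exact Or.inr h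

/-- The Carleson embedding inequality for stopping sets. -/
theorem exists_sum_stopping_le {X : Type*} [MeasurableSpace X] (p : ℝ) (hp : 1 < p) : ∃ C : ℝ≥0, ∀ (μ : Measure X)
    (f : X → ℝ≥0∞), Measurable f → ∀ 𝒦 : Finset (ℤ × Set X), (∀ κ ∈ 𝒦, MeasurableSet κ.2) →
    (∀ κ ∈ 𝒦, μ κ.2 ≠ ∞) → (∀ κ ∈ 𝒦, 2 ^ κ.1 * μ κ.2 ≤ ∫⁻ x in κ.2, f x ∂μ) →
    (∀ κ ∈ 𝒦, ∀ κ' ∈ 𝒦, κ.1 = κ'.1 → κ.2 = κ'.2 ∨ Disjoint κ.2 κ'.2) →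
    ∑ κ ∈ 𝒦, ((2 : ℝ≥0∞) ^ κ.1) ^ p * μ κ.2 ≤ C * ∫⁻ x, f x ^ p ∂μ := by
  classical
  obtain ⟨C, hC⟩ := exists_sum_zpow_rpow_le (p - 1) (by linarith)
  refine ⟨2 * C * 2 ^ (p - 1), fun μ f hf 𝒦 hm hfin havg hdisj => ?_⟩
  have hset : ∀ l : ℤ, MeasurableSet {x | (2 : ℝ≥0∞) ^ l ≤ 2 * f x} := fun l =>
    measurableSet_le measurable_const (hf.const_mul 2)
  have hpos : ∀ l : ℤ, (2 : ℝ≥0∞) ^ l ≠ 0 := fun l =>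
    (ENNReal.zpow_pos (by norm_num) (by norm_num) l).ne'
  have htop : ∀ l : ℤ, (2 : ℝ≥0∞) ^ l ≠ ∞ := fun l =>
    (ENNReal.zpow_lt_top (by norm_num) (by norm_num) l).ne
  -- On `κ.2` the part where `2 * f < 2 ^ κ.1` accounts for at most half of the lower bound `2 ^ κ.1
  -- * μ κ.2`, so the large values of `f` carry the rest.
  have step : ∀ κ ∈ 𝒦, 2 ^ κ.1 * μ κ.2 ≤
      2 * ∫⁻ x in κ.2, {x | (2 : ℝ≥0∞) ^ κ.1 ≤ 2 * f x}.indicator f x ∂μ := by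
    intro κ hκ
    have h1 : ∫⁻ x in κ.2, 2 * f x ∂μ ≤ ∫⁻ x in κ.2, (2 ^ κ.1 +
        2 * {x | (2 : ℝ≥0∞) ^ κ.1 ≤ 2 * f x}.indicator f x) ∂μ := by
      refine lintegral_mono fun x => ?_
      by_cases hx : (2 : ℝ≥0∞) ^ κ.1 ≤ 2 * f x
      · rw [Set.indicator_of_mem (by exact hx)]; exact le_add_self
      · exact (not_le.1 hx).le.trans le_self_add
    rw [lintegral_add_left measurable_const, setLIntegral_const,
      lintegral_const_mul _ hf, lintegral_const_mul _ (hf.indicator (hset _))] at h1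
    have h2 : 2 ^ κ.1 * μ κ.2 + 2 ^ κ.1 * μ κ.2 ≤ 2 ^ κ.1 * μ κ.2 +
        2 * ∫⁻ x in κ.2, {x | (2 : ℝ≥0∞) ^ κ.1 ≤ 2 * f x}.indicator f x ∂μ := by
      rw [← two_mul]
      refine le_trans ?_ h1
      gcongr
      exact havg κ hκ
    exact (ENNReal.add_le_add_iff_left (ENNReal.mul_ne_top (htop _) (hfin κ hκ))).1 h2
  calc ∑ κ ∈ 𝒦, ((2 : ℝ≥0∞) ^ κ.1) ^ p * μ κ.2
      ≤ ∑ κ ∈ 𝒦, ∫⁻ x, 2 * (κ.2.indicator ({x | (2 : ℝ≥0∞) ^ κ.1 ≤ 2 * f x}.indicator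
          (fun x => ((2 : ℝ≥0∞) ^ κ.1) ^ (p - 1) * f x)) x) ∂μ := by
        refine Finset.sum_le_sum fun κ hκ => ?_
        have e : ((2 : ℝ≥0∞) ^ κ.1) ^ p = ((2 : ℝ≥0∞) ^ κ.1) ^ (p - 1) * 2 ^ κ.1 := by
          conv_rhs => rw [← ENNReal.rpow_one (2 ^ κ.1 : ℝ≥0∞), ← ENNReal.rpow_mul,
            ← ENNReal.rpow_add _ _ (hpos _) (htop _)]
          ring_nf
        rw [e, mul_assoc]
        refine (mul_le_mul_right (step κ hκ) _).trans (le_of_eq ?_)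
        rw [lintegral_const_mul _ (((hf.const_mul _).indicator (hset _)).indicator (hm κ hκ)),
          lintegral_indicator (hm κ hκ), mul_left_comm,
          ← lintegral_const_mul _ (hf.indicator (hset _))]
        congr 1
        refine lintegral_congr fun x => ?_
        by_cases hx : (2 : ℝ≥0∞) ^ κ.1 ≤ 2 * f x
        · rw [Set.indicator_of_mem (by exact hx), Set.indicator_of_mem (by exact hx)]
        · rw [Set.indicator_of_notMem (by exact hx), Set.indicator_of_notMem (by exact hx), mul_zero]
    _ = ∫⁻ x, ∑ κ ∈ 𝒦, 2 * (κ.2.indicator ({x | (2 : ℝ≥0∞) ^ κ.1 ≤ 2 * f x}.indicator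
          (fun x => ((2 : ℝ≥0∞) ^ κ.1) ^ (p - 1) * f x)) x) ∂μ := by
        rw [lintegral_finsetSum' _ fun κ hκ => (((((hf.const_mul _).indicator (hset _)).indicator
          (hm κ hκ))).const_mul 2).aemeasurable]
    _ ≤ ∫⁻ x, (2 * C * 2 ^ (p - 1) : ℝ≥0) * f x ^ p ∂μ := by
        refine lintegral_mono fun x => ?_
        set 𝒥 := 𝒦.filter (fun κ => x ∈ κ.2 ∧ (2 : ℝ≥0∞) ^ κ.1 ≤ 2 * f x) with h𝒥
        -- Sets of one level are equal or disjoint, so at most one per level contains `x`. The sum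
        -- at `x` is then geometric over levels up to `2 * f x`.
        have hinj : Set.InjOn Prod.fst (𝒥 : Set (ℤ × Set X)) := by
          intro κ hκ κ' hκ' heq
          have h1 := Finset.mem_filter.1 hκ
          have h2 := Finset.mem_filter.1 hκ'
          refine Prod.ext heq ?_
          rcases hdisj κ h1.1 κ' h2.1 heq with h | h
          · exact h
          · exact absurd h2.2.1 (Set.disjoint_left.1 h h1.2.1)
        have h1 : ∑ κ ∈ 𝒦, 2 * (κ.2.indicator ({x | (2 : ℝ≥0∞) ^ κ.1 ≤ 2 * f x}.indicator
            (fun x => ((2 : ℝ≥0∞) ^ κ.1) ^ (p - 1) * f x)) x) =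
            2 * (∑ κ ∈ 𝒥, ((2 : ℝ≥0∞) ^ κ.1) ^ (p - 1)) * f x := by
          rw [h𝒥, Finset.sum_filter, mul_assoc, Finset.sum_mul, Finset.mul_sum]
          refine Finset.sum_congr rfl fun κ _ => ?_
          by_cases hx : x ∈ κ.2 <;> by_cases hx2 : (2 : ℝ≥0∞) ^ κ.1 ≤ 2 * f x <;> simp [hx, hx2]
        have h2 : ∑ κ ∈ 𝒥, ((2 : ℝ≥0∞) ^ κ.1) ^ (p - 1) ≤ C * (2 * f x) ^ (p - 1) := by
          refine le_trans (le_of_eq ?_) (hC (𝒥.image Prod.fst) (2 * f x))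
          rw [Finset.filter_true_of_mem, Finset.sum_image hinj]
          intro l hl
          obtain ⟨κ, hκ, rfl⟩ := Finset.mem_image.1 hl
          exact (Finset.mem_filter.1 hκ).2.2
        rw [h1]
        calc 2 * (∑ κ ∈ 𝒥, ((2 : ℝ≥0∞) ^ κ.1) ^ (p - 1)) * f x
            ≤ 2 * (C * (2 * f x) ^ (p - 1)) * f x := by gcongr
          _ = 2 * C * 2 ^ (p - 1) * (f x ^ (p - 1) * f x ^ (1 : ℝ)) := by
            rw [ENNReal.mul_rpow_of_nonneg _ _ (by linarith), ENNReal.rpow_one]; ring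
          _ = _ := by
            rw [← ENNReal.rpow_add_of_nonneg _ _ (by linarith) zero_le_one, sub_add_cancel]
            congr 1
            rw [ENNReal.coe_mul, ENNReal.coe_mul, ENNReal.coe_rpow_of_nonneg _ (by linarith)]
            rfl
    _ = _ := lintegral_const_mul _ (hf.pow_const _)

/-- One half of the parallel stopping argument: members of the family whose `U`-stopping set lies
inside the `S`-stopping set. -/
theorem sum_stopping_nested_le {X ι : Type*} [MeasurableSpace X] [Fintype ι] {p p' q q' : ℝ} (hp : p.HolderConjugate p')
    (hq : q.HolderConjugate q') (hqp : q' ≤ p') (S U : Measure X) (Q : ι → Set X)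
    (hQ : ∀ i, MeasurableSet (Q i)) (hne : ∀ i, (Q i).Nonempty) (w : ι → ℝ≥0∞)
    (A : ℝ≥0∞)
    (htest : ∀ j, (∫⁻ x, (∑ i, {i | Q i ⊆ Q j}.indicator
      (fun i => w i * S (Q i) * (Q i).indicator 1 x) i) ^ q ∂U) ^ (1 / q) ≤ A * S (Q j) ^ (1 / p))
    (l k : ι → ℤ) (F G : ι → Set X) (hF : ∀ i, Q i ⊆ F i) (hG : ∀ i, Q i ⊆ G i)
    (hFQ : ∀ i, ∃ j, F i = Q j) (hGQ : ∀ i, ∃ j, G i = Q j)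
    (hl : ∀ i i', Q i' ⊆ F i → l i ≤ l i')
    (hdisj : ∀ i i', l i = l i' → F i = F i' ∨ Disjoint (F i) (F i'))
    (I : Finset ι) (hI : ∀ i ∈ I, G i ⊆ F i) (𝒦 ℋ : Finset (ℤ × Set X))
    (h𝒦 : ∀ i, (l i, F i) ∈ 𝒦) (hℋ : ∀ i, (k i, G i) ∈ ℋ) :
    ∑ i ∈ I, w i * S (Q i) * U (Q i) * 2 ^ l i * 2 ^ k i ≤
      A * (∑ κ ∈ 𝒦, ((2 : ℝ≥0∞) ^ κ.1) ^ p * S κ.2) ^ (1 / p) *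
        (∑ γ ∈ ℋ, ((2 : ℝ≥0∞) ^ γ.1) ^ q' * U γ.2) ^ (1 / q') := by
  classical
  have hp0 := hp.pos
  have hp0' := hp.symm.pos
  have hq0 := hq.pos
  have hq0' := hq.symm.pos
  set φ : ι → ℤ × Set X := fun i => (l i, F i) with hφ
  set γ : ι → ℤ × Set X := fun i => (k i, G i) with hγ
  -- The inner stopping pair determines the outer one: a common `G` lies in both `F i` and `F i'`,
  -- which forces equal levels, and two stopping sets of equal level that meet coincide.
  have hγφ : ∀ i ∈ I, ∀ i' ∈ I, γ i = γ i' → φ i = φ i' := by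
    intro i hi i' hi' h
    have hGG : G i = G i' := congrArg Prod.snd h
    have h1 : Q i' ⊆ F i := (hG i').trans (hGG ▸ hI i hi)
    have h2 : Q i ⊆ F i' := (hG i).trans (hGG ▸ hI i' hi')
    have hll : l i = l i' := le_antisymm (hl _ _ h1) (hl _ _ h2)
    refine Prod.ext hll ?_
    rcases hdisj i i' hll with h | h
    · exact h
    · obtain ⟨x, hx⟩ := hne i
      exact absurd (h2 hx) (Set.disjoint_left.1 h (hF i hx))
  set Γ : ℤ × Set X → Finset (ℤ × Set X) := fun κ => (I.filter (fun i => φ i = κ)).image γ with hΓ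
  set N : ℤ × Set X → ℝ≥0∞ := fun κ => ∑ g ∈ Γ κ, ((2 : ℝ≥0∞) ^ g.1) ^ q' * U g.2 with hN
  have fiber : ∀ κ ∈ 𝒦, ∑ i ∈ I with φ i = κ, w i * S (Q i) * U (Q i) * 2 ^ l i * 2 ^ k i ≤
      A * (((2 : ℝ≥0∞) ^ κ.1 * S κ.2 ^ (1 / p)) * N κ ^ (1 / q')) := by
    intro κ _
    rcases (I.filter (fun i => φ i = κ)).eq_empty_or_nonempty with he | ⟨i0, hi0⟩
    · rw [he]; simp
    obtain ⟨j, hj⟩ := hFQ i0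
    have hκ2 : κ.2 = Q j := by rw [← (Finset.mem_filter.1 hi0).2, ← hj]
    set T : X → ℝ≥0∞ := fun x => ∑ i, {i | Q i ⊆ Q j}.indicator
      (fun i => w i * S (Q i) * (Q i).indicator 1 x) i with hT
    -- For fixed outer pair, the inner levels are replaced by their pointwise maximum `H`. The sum
    -- then factors through the localized testing function `T`, and Hölder leaves the testing bound
    -- for `T` and the partial Carleson sum `N κ` for `H`.
    set H : X → ℝ≥0∞ := fun x => (I.filter (fun i => φ i = κ)).sup
      (fun i => (Q i).indicator (fun _ => (2 : ℝ≥0∞) ^ k i) x) with hH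
    have hTm : Measurable T := by
      refine Finset.measurable_sum _ fun i _ => ?_
      by_cases hi : i ∈ {i | Q i ⊆ Q j}
      · simp only [Set.indicator_of_mem hi]
        exact (measurable_one.indicator (hQ i)).const_mul _
      · simp only [Set.indicator_of_notMem hi]
        exact measurable_const
    have hHm : Measurable H := by
      simp only [hH, Finset.sup_eq_iSup]
      exact Measurable.biSup _ (Finset.countable_toSet _) fun i _ =>
        measurable_const.indicator (hQ i)
    have hHN : ∫⁻ x, H x ^ q' ∂U ≤ N κ := by
      calc ∫⁻ x, H x ^ q' ∂U ≤ ∫⁻ x, ∑ g ∈ Γ κ, g.2.indicator (fun _ => ((2 : ℝ≥0∞) ^ g.1) ^ q') x ∂U := by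
            refine lintegral_mono fun x => ?_
            have : H x ≤ (∑ g ∈ Γ κ, g.2.indicator (fun _ => ((2 : ℝ≥0∞) ^ g.1) ^ q') x) ^ (1 / q') := by
              refine Finset.sup_le fun i hi => ?_
              by_cases hx : x ∈ Q i
              · rw [Set.indicator_of_mem hx]
                have h1 : γ i ∈ Γ κ := Finset.mem_image_of_mem _ hi
                have h2 := Finset.single_le_sum (s := Γ κ)
                  (f := fun g => g.2.indicator (fun _ => ((2 : ℝ≥0∞) ^ g.1) ^ q') x)
                  (fun _ _ => bot_le) h1
                rw [Set.indicator_of_mem (hG i hx)] at h2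
                calc (2 : ℝ≥0∞) ^ k i = (((2 : ℝ≥0∞) ^ k i) ^ q') ^ (1 / q') := by
                      rw [← ENNReal.rpow_mul, mul_one_div_cancel hq0'.ne', ENNReal.rpow_one]
                  _ ≤ _ := ENNReal.rpow_le_rpow h2 (by positivity)
              · rw [Set.indicator_of_notMem hx]; exact bot_le
            calc H x ^ q' ≤ _ := ENNReal.rpow_le_rpow this hq0'.le
              _ = _ := by rw [← ENNReal.rpow_mul, one_div_mul_cancel hq0'.ne', ENNReal.rpow_one]
        _ = N κ := by
            have hm : ∀ g ∈ Γ κ, MeasurableSet g.2 := by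
              intro g hg
              obtain ⟨i, _, rfl⟩ := Finset.mem_image.1 hg
              obtain ⟨j', hj'⟩ := hGQ i
              simp only [hγ, hj', hQ]
            rw [lintegral_finsetSum' _ fun g hg => (measurable_const.indicator (hm g hg)).aemeasurable]
            refine Finset.sum_congr rfl fun g hg => ?_
            rw [lintegral_indicator_const (hm g hg)]
    calc ∑ i ∈ I with φ i = κ, w i * S (Q i) * U (Q i) * 2 ^ l i * 2 ^ k i
        = 2 ^ κ.1 * ∫⁻ x, ∑ i ∈ I with φ i = κ,
            w i * S (Q i) * 2 ^ k i * (Q i).indicator 1 x ∂U := by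
          rw [lintegral_finsetSum' _ fun i _ =>
            ((measurable_one.indicator (hQ i)).const_mul _).aemeasurable, Finset.mul_sum]
          refine Finset.sum_congr rfl fun i hi => ?_
          rw [lintegral_const_mul _ (measurable_one.indicator (hQ i)), lintegral_indicator_one (hQ i),
            ← (Finset.mem_filter.1 hi).2]
          simp only [hφ]; ring
      _ ≤ 2 ^ κ.1 * ∫⁻ x, T x * H x ∂U := by
          gcongr with x
          calc ∑ i ∈ I with φ i = κ, w i * S (Q i) * 2 ^ k i * (Q i).indicator 1 x
              ≤ ∑ i ∈ I with φ i = κ, (w i * S (Q i) * (Q i).indicator 1 x) * H x := by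
                refine Finset.sum_le_sum fun i hi => ?_
                by_cases hx : x ∈ Q i
                · have := Finset.le_sup (f := fun i => (Q i).indicator (fun _ => (2 : ℝ≥0∞) ^ k i) x) hi
                  simp only [Set.indicator_of_mem hx] at this
                  simp only [Set.indicator_of_mem hx, Pi.one_apply, mul_one]
                  exact mul_le_mul_right this _
                · simp [hx]
            _ ≤ T x * H x := by
                rw [← Finset.sum_mul]
                gcongr
                calc ∑ i ∈ I with φ i = κ, (w i * S (Q i) * (Q i).indicator 1 x)
                    = ∑ i ∈ I with φ i = κ, {i | Q i ⊆ Q j}.indicator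
                        (fun i => w i * S (Q i) * (Q i).indicator 1 x) i := by
                      refine Finset.sum_congr rfl fun i hi => ?_
                      have : i ∈ {i | Q i ⊆ Q j} := by
                        have h1 := hF i
                        have h2 : F i = κ.2 := congrArg Prod.snd (Finset.mem_filter.1 hi).2
                        rw [h2, hκ2] at h1
                        exact h1
                      rw [Set.indicator_of_mem this]
                  _ ≤ _ := Finset.sum_le_sum_of_subset (Finset.subset_univ _)
      _ ≤ 2 ^ κ.1 * ((∫⁻ x, T x ^ q ∂U) ^ (1 / q) * (∫⁻ x, H x ^ q' ∂U) ^ (1 / q')) := by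
          gcongr
          exact ENNReal.lintegral_mul_le_Lp_mul_Lq U hq hTm.aemeasurable hHm.aemeasurable
      _ ≤ 2 ^ κ.1 * ((A * S κ.2 ^ (1 / p)) * N κ ^ (1 / q')) := by
          gcongr
          rw [hκ2]; exact htest j
      _ = _ := by ring
  -- By `hγφ` the sets `Γ κ` are disjoint, so each inner stopping pair is counted only once.
  have hNsum : ∑ κ ∈ 𝒦, N κ ≤ ∑ g ∈ ℋ, ((2 : ℝ≥0∞) ^ g.1) ^ q' * U g.2 := by
    rw [← Finset.sum_biUnion]
    · refine Finset.sum_le_sum_of_subset fun g hg => ?_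
      obtain ⟨κ, _, hg⟩ := Finset.mem_biUnion.1 hg
      obtain ⟨i, _, rfl⟩ := Finset.mem_image.1 hg
      exact hℋ i
    · intro κ _ κ' _ hκκ'
      refine Finset.disjoint_left.2 fun g hg hg' => hκκ' ?_
      obtain ⟨i, hi, rfl⟩ := Finset.mem_image.1 hg
      obtain ⟨i', hi', h⟩ := Finset.mem_image.1 hg'
      have h1 := Finset.mem_filter.1 hi
      have h2 := Finset.mem_filter.1 hi'
      rw [← h1.2, ← h2.2]
      exact hγφ i h1.1 i' h2.1 h.symm
  calc ∑ i ∈ I, w i * S (Q i) * U (Q i) * 2 ^ l i * 2 ^ k i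
      = ∑ κ ∈ 𝒦, ∑ i ∈ I with φ i = κ, w i * S (Q i) * U (Q i) * 2 ^ l i * 2 ^ k i :=
        (Finset.sum_fiberwise_of_maps_to (fun i _ => h𝒦 i) _).symm
    _ ≤ ∑ κ ∈ 𝒦, A * (((2 : ℝ≥0∞) ^ κ.1 * S κ.2 ^ (1 / p)) * N κ ^ (1 / q')) :=
        Finset.sum_le_sum fiber
    _ = A * ∑ κ ∈ 𝒦, ((2 : ℝ≥0∞) ^ κ.1 * S κ.2 ^ (1 / p)) * N κ ^ (1 / q') := by
        rw [Finset.mul_sum]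
    _ ≤ A * ((∑ κ ∈ 𝒦, ((2 : ℝ≥0∞) ^ κ.1 * S κ.2 ^ (1 / p)) ^ p) ^ (1 / p) *
          (∑ κ ∈ 𝒦, (N κ ^ (1 / q')) ^ p') ^ (1 / p')) := by
        gcongr
        exact ENNReal.inner_le_Lp_mul_Lq _ _ _ hp
    _ ≤ A * ((∑ κ ∈ 𝒦, ((2 : ℝ≥0∞) ^ κ.1) ^ p * S κ.2) ^ (1 / p) *
          (∑ g ∈ ℋ, ((2 : ℝ≥0∞) ^ g.1) ^ q' * U g.2) ^ (1 / q')) := by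
        gcongr with κ hκ
        · rw [ENNReal.mul_rpow_of_nonneg _ _ hp0.le, ← ENNReal.rpow_mul (S κ.2),
            one_div_mul_cancel hp0.ne', ENNReal.rpow_one]
        · calc (∑ κ ∈ 𝒦, (N κ ^ (1 / q')) ^ p') ^ (1 / p')
              = (∑ κ ∈ 𝒦, N κ ^ (p' / q')) ^ (1 / p') := by
                simp_rw [← ENNReal.rpow_mul]
                congr 1; refine Finset.sum_congr rfl fun κ _ => ?_
                congr 1; ring
            _ ≤ ((∑ κ ∈ 𝒦, N κ) ^ (p' / q')) ^ (1 / p') := by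
                gcongr
                exact sum_rpow_le_rpow_sum _ _ ((one_le_div hq0').2 hqp)
            _ = (∑ κ ∈ 𝒦, N κ) ^ (1 / q') := by
                rw [← ENNReal.rpow_mul]; congr 1; field_simp
            _ ≤ _ := by gcongr
    _ = _ := by ring

theorem setLIntegral_ne_top_of_rpow {X : Type*} [MeasurableSpace X] {p p' : ℝ}
    (hp : p.HolderConjugate p') (μ : Measure X) {f : X → ℝ≥0∞} (hf : Measurable f)
    (hfp : ∫⁻ x, f x ^ p ∂μ ≠ ∞) {s : Set X} (hs : μ s ≠ ∞) : ∫⁻ x in s, f x ∂μ ≠ ∞ := by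
  have h := ENNReal.lintegral_mul_le_Lp_mul_Lq (μ.restrict s) hp hf.aemeasurable
    (aemeasurable_const (b := (1 : ℝ≥0∞)))
  simp only [Pi.mul_apply, mul_one, ENNReal.one_rpow, lintegral_const,
    Measure.restrict_apply MeasurableSet.univ, Set.univ_inter, one_mul] at h
  have hp0 := hp.pos
  have hp0' := hp.symm.pos
  refine ne_top_of_le_ne_top (ENNReal.mul_ne_top ?_ ?_) h
  · exact ENNReal.rpow_ne_top_of_nonneg (by positivity)
      (ne_top_of_le_ne_top hfp (setLIntegral_le_lintegral _ _))
  · exact ENNReal.rpow_ne_top_of_nonneg (by positivity) hs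

theorem le_of_holderConjugate_le {p p' q q' : ℝ} (hp : p.HolderConjugate p')
    (hq : q.HolderConjugate q') (hqp : q' ≤ p') : p ≤ q := by
  have h1 := hp.inv_add_inv_eq_one
  have h2 := hq.inv_add_inv_eq_one
  have h3 := inv_anti₀ hq.symm.pos hqp
  exact (inv_le_inv₀ hq.pos hp.pos).1 (by linarith)

/-- The off-diagonal two weight testing theorem for a positive form over a finite laminar family,
when no local integral vanishes. -/
theorem exists_sum_laminar_le_of_ne_zero {X : Type*} [MeasurableSpace X] {p p' q q' : ℝ} (hp : p.HolderConjugate p')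
    (hq : q.HolderConjugate q') (hqp : q' ≤ p') : ∃ C : ℝ≥0,
    ∀ (ι : Type) [Fintype ι] (S U : Measure X) (Q : ι → Set X),
    (∀ i, MeasurableSet (Q i)) → (∀ i j, Q i ⊆ Q j ∨ Q j ⊆ Q i ∨ Disjoint (Q i) (Q j)) →
    (∀ i, S (Q i) ≠ ∞) → (∀ i, U (Q i) ≠ ∞) → ∀ (w : ι → ℝ≥0∞) (A B : ℝ≥0∞),
    (∀ j, (∫⁻ x, (∑ i, {i | Q i ⊆ Q j}.indicator
      (fun i => w i * S (Q i) * (Q i).indicator 1 x) i) ^ q ∂U) ^ (1 / q) ≤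
        A * S (Q j) ^ (1 / p)) →
    (∀ j, (∫⁻ x, (∑ i, {i | Q i ⊆ Q j}.indicator
      (fun i => w i * U (Q i) * (Q i).indicator 1 x) i) ^ p' ∂S) ^ (1 / p') ≤
        B * U (Q j) ^ (1 / q')) →
    ∀ f g : X → ℝ≥0∞, Measurable f → Measurable g → ∫⁻ x, f x ^ p ∂S ≠ ∞ →
    ∫⁻ x, g x ^ q' ∂U ≠ ∞ → (∀ i, ∫⁻ x in Q i, f x ∂S ≠ 0) → (∀ i, ∫⁻ x in Q i, g x ∂U ≠ 0) →
    ∑ i, w i * (∫⁻ x in Q i, f x ∂S) * (∫⁻ x in Q i, g x ∂U) ≤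
      C * (A + B) * (∫⁻ x, f x ^ p ∂S) ^ (1 / p) * (∫⁻ x, g x ^ q' ∂U) ^ (1 / q') := by
  have hp0 := hp.pos
  have hp0' := hp.symm.pos
  have hq0 := hq.pos
  have hq0' := hq.symm.pos
  obtain ⟨C₁, hC₁⟩ := exists_sum_stopping_le (X := X) p hp.lt
  obtain ⟨C₂, hC₂⟩ := exists_sum_stopping_le (X := X) q' hq.symm.lt
  have e1 : (0 : ℝ) ≤ 1 / p := by positivity
  have e2 : (0 : ℝ) ≤ 1 / q' := by positivity
  refine ⟨4 * C₁ ^ (1 / p) * C₂ ^ (1 / q'), ?_⟩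
  intro ι _ S U Q hQ hlam hS hU w A B htS htU f g hf hg hfp hgq hf0 hg0
  classical
  have hne : ∀ i, (Q i).Nonempty := fun i => by
    rw [Set.nonempty_iff_ne_empty]
    intro h
    exact hf0 i (by simp [h])
  set a : ι → ℝ≥0∞ := fun i => (S (Q i))⁻¹ * ∫⁻ x in Q i, f x ∂S with ha
  set b : ι → ℝ≥0∞ := fun i => (U (Q i))⁻¹ * ∫⁻ x in Q i, g x ∂U with hb
  have hS0 : ∀ i, S (Q i) ≠ 0 := fun i h => hf0 i (setLIntegral_measure_zero _ _ h)
  have hU0 : ∀ i, U (Q i) ≠ 0 := fun i h => hg0 i (setLIntegral_measure_zero _ _ h)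
  obtain ⟨l, F, hF, hal, hFQ, hl, hFd⟩ := exists_stopping Q hlam a
    (fun i => mul_ne_zero (ENNReal.inv_ne_zero.2 (hS i)) (hf0 i))
    (fun i => ENNReal.mul_ne_top (ENNReal.inv_ne_top.2 (hS0 i))
      (setLIntegral_ne_top_of_rpow hp S hf hfp (hS i)))
  obtain ⟨k, G, hG, hbk, hGQ, hk, hGd⟩ := exists_stopping Q hlam b
    (fun i => mul_ne_zero (ENNReal.inv_ne_zero.2 (hU i)) (hg0 i))
    (fun i => ENNReal.mul_ne_top (ENNReal.inv_ne_top.2 (hU0 i))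
      (setLIntegral_ne_top_of_rpow hq.symm U hg hgq (hU i)))
  set 𝒦 : Finset (ℤ × Set X) := Finset.univ.image (fun i => (l i, F i))
  set ℋ : Finset (ℤ × Set X) := Finset.univ.image (fun i => (k i, G i))
  have h𝒦 : ∀ i, (l i, F i) ∈ 𝒦 := fun i => Finset.mem_image_of_mem _ (Finset.mem_univ i)
  have hℋ : ∀ i, (k i, G i) ∈ ℋ := fun i => Finset.mem_image_of_mem _ (Finset.mem_univ i)
  have hfa : ∀ i, ∫⁻ x in Q i, f x ∂S = a i * S (Q i) := fun i => by
    simp only [ha]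
    rw [mul_comm, ← mul_assoc, ENNReal.mul_inv_cancel (hS0 i) (hS i), one_mul]
  have hgb : ∀ i, ∫⁻ x in Q i, g x ∂U = b i * U (Q i) := fun i => by
    simp only [hb]
    rw [mul_comm, ← mul_assoc, ENNReal.mul_inv_cancel (hU0 i) (hU i), one_mul]
  have hK : ∑ κ ∈ 𝒦, ((2 : ℝ≥0∞) ^ κ.1) ^ p * S κ.2 ≤ C₁ * ∫⁻ x, f x ^ p ∂S := by
    refine hC₁ S f hf 𝒦 ?_ ?_ ?_ ?_
    · intro κ hκ
      obtain ⟨i, _, rfl⟩ := Finset.mem_image.1 hκ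
      obtain ⟨j, hj, _⟩ := hFQ i
      simp only [hj, hQ]
    · intro κ hκ
      obtain ⟨i, _, rfl⟩ := Finset.mem_image.1 hκ
      obtain ⟨j, hj, _⟩ := hFQ i
      simpa only [hj] using hS j
    · intro κ hκ
      obtain ⟨i, _, rfl⟩ := Finset.mem_image.1 hκ
      obtain ⟨j, hj, hj'⟩ := hFQ i
      simp only [hj]
      rw [hfa]; gcongr
    · intro κ hκ κ' hκ' h
      obtain ⟨i, _, rfl⟩ := Finset.mem_image.1 hκ
      obtain ⟨i', _, rfl⟩ := Finset.mem_image.1 hκ'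
      exact hFd i i' h
  have hH : ∑ κ ∈ ℋ, ((2 : ℝ≥0∞) ^ κ.1) ^ q' * U κ.2 ≤ C₂ * ∫⁻ x, g x ^ q' ∂U := by
    refine hC₂ U g hg ℋ ?_ ?_ ?_ ?_
    · intro κ hκ
      obtain ⟨i, _, rfl⟩ := Finset.mem_image.1 hκ
      obtain ⟨j, hj, _⟩ := hGQ i
      simp only [hj, hQ]
    · intro κ hκ
      obtain ⟨i, _, rfl⟩ := Finset.mem_image.1 hκ
      obtain ⟨j, hj, _⟩ := hGQ i
      simpa only [hj] using hU j
    · intro κ hκ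
      obtain ⟨i, _, rfl⟩ := Finset.mem_image.1 hκ
      obtain ⟨j, hj, hj'⟩ := hGQ i
      simp only [hj]
      rw [hgb]; gcongr
    · intro κ hκ κ' hκ' h
      obtain ⟨i, _, rfl⟩ := Finset.mem_image.1 hκ
      obtain ⟨i', _, rfl⟩ := Finset.mem_image.1 hκ'
      exact hGd i i' h
  have hFQ' : ∀ i, ∃ j, F i = Q j := fun i => (hFQ i).imp fun _ h => h.1
  have hGQ' : ∀ i, ∃ j, G i = Q j := fun i => (hGQ i).imp fun _ h => h.1
  -- Both stopping sets belong to the laminar family and contain the nonempty `Q i`, so they are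
  -- nested one way or the other.
  have hsplit : ∀ i, ¬ G i ⊆ F i → F i ⊆ G i := by
    intro i hi
    obtain ⟨j, hj⟩ := hFQ' i
    obtain ⟨j', hj'⟩ := hGQ' i
    rcases hlam j j' with h | h | h
    · rw [hj, hj']; exact h
    · exact absurd (by rw [hj, hj']; exact h) hi
    · obtain ⟨x, hx⟩ := hne i
      exact absurd (hj' ▸ hG i hx) (Set.disjoint_left.1 h (hj ▸ hF i hx))
  have half₁ := sum_stopping_nested_le hp hq hqp S U Q hQ hne w A htS l k F G hF hG hFQ' hGQ' hl
    hFd (Finset.univ.filter fun i => G i ⊆ F i) (fun i hi => (Finset.mem_filter.1 hi).2) 𝒦 ℋ h𝒦 hℋ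
  -- The same estimate with the two measures exchanged; its exponent condition becomes `p ≤ q`.
  have half₂ := sum_stopping_nested_le hq.symm hp.symm
    (le_of_holderConjugate_le hp hq hqp) U S Q hQ hne w B htU k l G F
    hG hF hGQ' hFQ' hk hGd (Finset.univ.filter fun i => ¬ G i ⊆ F i)
    (fun i hi => hsplit i (Finset.mem_filter.1 hi).2) ℋ 𝒦 hℋ h𝒦
  set P : ℝ≥0∞ := (C₁ * ∫⁻ x, f x ^ p ∂S) ^ (1 / p)
  set R : ℝ≥0∞ := (C₂ * ∫⁻ x, g x ^ q' ∂U) ^ (1 / q')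
  have hPle := ENNReal.rpow_le_rpow hK e1
  have hRle := ENNReal.rpow_le_rpow hH e2
  calc ∑ i, w i * (∫⁻ x in Q i, f x ∂S) * (∫⁻ x in Q i, g x ∂U)
      -- Each average is at most twice its stopping value `2 ^ l i` or `2 ^ k i`, whence the 4.
      ≤ ∑ i, 4 * (w i * S (Q i) * U (Q i) * 2 ^ l i * 2 ^ k i) := by
        refine Finset.sum_le_sum fun i _ => ?_
        rw [hfa, hgb]
        calc w i * (a i * S (Q i)) * (b i * U (Q i))
            ≤ w i * (2 ^ (l i + 1) * S (Q i)) * (2 ^ (k i + 1) * U (Q i)) := by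
              gcongr
              · exact hal i
              · exact hbk i
          _ = _ := by
              rw [ENNReal.zpow_add (by norm_num) (by norm_num),
                ENNReal.zpow_add (by norm_num) (by norm_num), zpow_one]; ring
    _ = 4 * (∑ i with G i ⊆ F i, w i * S (Q i) * U (Q i) * 2 ^ l i * 2 ^ k i +
          ∑ i with ¬ G i ⊆ F i, w i * U (Q i) * S (Q i) * 2 ^ k i * 2 ^ l i) := by
        rw [← Finset.mul_sum, ← Finset.sum_filter_add_sum_filter_not _ (fun i => G i ⊆ F i)]
        congr 2
        refine Finset.sum_congr rfl fun i _ => by ring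
    _ ≤ 4 * (A * P * R + B * R * P) := by
        gcongr
        · exact half₁.trans (mul_le_mul' (mul_le_mul' le_rfl hPle) hRle)
        · exact half₂.trans (mul_le_mul' (mul_le_mul' le_rfl hRle) hPle)
    _ = _ := by
        simp only [P, R]
        rw [ENNReal.mul_rpow_of_nonneg _ _ e1, ENNReal.mul_rpow_of_nonneg _ _ e2,
          ENNReal.coe_mul, ENNReal.coe_mul, ENNReal.coe_rpow_of_nonneg _ e1,
          ENNReal.coe_rpow_of_nonneg _ e2]
        push_cast
        ring

/-- The off-diagonal two weight testing theorem for a positive form over a finite laminar family. -/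
theorem exists_sum_laminar_le {X : Type*} [MeasurableSpace X] {p p' q q' : ℝ} (hp : p.HolderConjugate p')
    (hq : q.HolderConjugate q') (hqp : q' ≤ p') : ∃ C : ℝ≥0,
    ∀ (ι : Type) [Fintype ι] (S U : Measure X) (Q : ι → Set X),
    (∀ i, MeasurableSet (Q i)) → (∀ i j, Q i ⊆ Q j ∨ Q j ⊆ Q i ∨ Disjoint (Q i) (Q j)) →
    (∀ i, S (Q i) ≠ ∞) → (∀ i, U (Q i) ≠ ∞) → ∀ (w : ι → ℝ≥0∞) (A B : ℝ≥0∞),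
    (∀ j, (∫⁻ x, (∑ i, {i | Q i ⊆ Q j}.indicator
      (fun i => w i * S (Q i) * (Q i).indicator 1 x) i) ^ q ∂U) ^ (1 / q) ≤
        A * S (Q j) ^ (1 / p)) →
    (∀ j, (∫⁻ x, (∑ i, {i | Q i ⊆ Q j}.indicator
      (fun i => w i * U (Q i) * (Q i).indicator 1 x) i) ^ p' ∂S) ^ (1 / p') ≤
        B * U (Q j) ^ (1 / q')) →
    ∀ f g : X → ℝ≥0∞, Measurable f → Measurable g → ∫⁻ x, f x ^ p ∂S ≠ ∞ →
    ∫⁻ x, g x ^ q' ∂U ≠ ∞ →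
    ∑ i, w i * (∫⁻ x in Q i, f x ∂S) * (∫⁻ x in Q i, g x ∂U) ≤
      C * (A + B) * (∫⁻ x, f x ^ p ∂S) ^ (1 / p) * (∫⁻ x, g x ^ q' ∂U) ^ (1 / q') := by
  obtain ⟨C, hC⟩ := exists_sum_laminar_le_of_ne_zero (X := X) hp hq hqp
  refine ⟨C, ?_⟩
  intro ι _ S U Q hQ hlam hS hU w A B htS htU f g hf hg hfp hgq
  classical
  have hq0 := hq.pos
  have hp0' := hp.symm.pos
  -- Members with a vanishing local integral contribute nothing to the form, and deleting them only
  -- lowers the testing sums.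
  let N : ι → Prop := fun i => ∫⁻ x in Q i, f x ∂S ≠ 0 ∧ ∫⁻ x in Q i, g x ∂U ≠ 0
  have hsub : ∀ h : ι → ℝ≥0∞, ∑ i : {i // N i}, h i ≤ ∑ i, h i := fun h => by
    rw [← Finset.sum_subtype (Finset.univ.filter N) (by simp) h]
    exact Finset.sum_le_sum_of_subset (Finset.subset_univ _)
  have hind : ∀ (j : {i // N i}) (h : ι → ℝ≥0∞),
      ∑ i : {i // N i}, {i : {i // N i} | Q i ⊆ Q j}.indicator (fun i => h i) i ≤
        ∑ i, {i | Q i ⊆ Q j}.indicator h i := fun j h =>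
    hsub (fun i => {i | Q i ⊆ Q j}.indicator h i)
  have key := hC {i // N i} S U (fun i => Q i) (fun i => hQ i) (fun i j => hlam i j)
    (fun i => hS i) (fun i => hU i) (fun i => w i) A B
    (fun j => le_trans (ENNReal.rpow_le_rpow (lintegral_mono fun x =>
      ENNReal.rpow_le_rpow (hind j (fun i => w i * S (Q i) * (Q i).indicator 1 x)) hq0.le)
      (by positivity)) (htS j))
    (fun j => le_trans (ENNReal.rpow_le_rpow (lintegral_mono fun x =>
      ENNReal.rpow_le_rpow (hind j (fun i => w i * U (Q i) * (Q i).indicator 1 x)) hp0'.le)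
      (by positivity)) (htU j))
    f g hf hg hfp hgq (fun i => i.2.1) (fun i => i.2.2)
  refine le_trans (le_of_eq ?_) key
  rw [← Finset.sum_subtype (Finset.univ.filter N) (by simp)
    (fun i => w i * (∫⁻ x in Q i, f x ∂S) * (∫⁻ x in Q i, g x ∂U))]
  refine (Finset.sum_subset (Finset.subset_univ _) fun i _ hi => ?_).symm
  have : ¬ N i := fun h => hi (Finset.mem_filter.2 ⟨Finset.mem_univ _, h⟩)
  simp only [N, not_and_or, not_not] at this
  rcases this with h | h <;> simp [h]

/-! ### Hedberg's estimate and the weak type inequality -/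

section Hedberg

open Metric Set

variable {E : Type*} [MetricSpace E] [MeasurableSpace E]

theorem exists_lt_measure_closedBall (μ : Measure E) {x : E} {r : ℝ} (hr : 0 < r) {c : ℝ≥0∞}
    (hc : c < μ (ball x r)) : ∃ s, 0 < s ∧ s < r ∧ c < μ (closedBall x s) := by
  obtain ⟨u, hu, hur, hlim⟩ := exists_seq_strictMono_tendsto' hr
  have hU : ball x r = ⋃ n, closedBall x (u n) := by
    ext y
    simp only [mem_ball, mem_iUnion, mem_closedBall]
    constructor
    · intro hy
      obtain ⟨n, hn⟩ := (hlim.eventually (lt_mem_nhds hy)).exists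
      exact ⟨n, hn.le⟩
    · rintro ⟨n, hn⟩
      exact hn.trans_lt (hur n).2
  have hmono : Monotone fun n => closedBall x (u n) := fun a b hab =>
    closedBall_subset_closedBall (hu.monotone hab)
  rw [hU, hmono.measure_iUnion] at hc
  obtain ⟨n, hn⟩ := lt_iSup_iff.1 hc
  exact ⟨u n, (hur n).1, (hur n).2, hn⟩

variable [BorelSpace E]

/-- Spheres may carry mass, so no ball need have mass exactly `v`. The radius is the supremum of
those whose closed ball has mass at most `v`: such radii exist because `{x}` is null, and are
bounded because `v < U univ`. Continuity of `U` from below bounds the open ball, continuity from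
above the closed one. -/
theorem exists_radius_measure_ball_le (U : Measure E) [ProperSpace E]
    [IsFiniteMeasureOnCompacts U] (x : E) (hx : U {x} = 0) {v : ℝ≥0∞} (hv0 : v ≠ 0) (hv : v < U univ) :
    ∃ r, 0 < r ∧ U (ball x r) ≤ v ∧ v ≤ U (closedBall x r) := by
  set T : Set ℝ := {r | 0 < r ∧ U (closedBall x r) ≤ v} with hT
  have htend : ∀ a : ℝ, Filter.Tendsto (fun r => U (closedBall x r)) (nhdsWithin a (Ioi a))
      (nhds (U (closedBall x a))) := by
    intro a
    have := tendsto_measure_biInter_gt (μ := U) (s := fun r => closedBall x r) (a := a)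
      (fun r _ => isClosed_closedBall.measurableSet.nullMeasurableSet)
      (fun i j _ hij => closedBall_subset_closedBall hij)
      ⟨a + 1, by simp, (isCompact_closedBall x (a + 1)).measure_lt_top.ne⟩
    rwa [show (⋂ r, ⋂ (_ : r > a), closedBall x r) = closedBall x a from
      biInter_gt_closedBall x a] at this
  have hne : T.Nonempty := by
    have h0 := htend 0
    rw [closedBall_zero, hx] at h0
    have h1 := (h0.eventually (gt_mem_nhds (pos_iff_ne_zero.2 hv0))).and self_mem_nhdsWithin
    obtain ⟨r, hr1, hr2⟩ := h1.exists
    exact ⟨r, hr2, hr1.le⟩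
  have hbdd : BddAbove T := by
    have hmono : Monotone fun n : ℕ => closedBall x (n : ℝ) := fun a b hab =>
      closedBall_subset_closedBall (by exact_mod_cast hab)
    have : univ = ⋃ n : ℕ, closedBall x (n : ℝ) := (iUnion_closedBall_nat x).symm
    rw [this, hmono.measure_iUnion] at hv
    obtain ⟨n, hn⟩ := lt_iSup_iff.1 hv
    refine ⟨n, fun r hr => ?_⟩
    by_contra hlt
    exact absurd ((measure_mono (closedBall_subset_closedBall (not_le.1 hlt).le)).trans hr.2)
      (not_le.2 hn)
  obtain ⟨s, hs⟩ := hne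
  have hr0 : 0 < sSup T := hs.1.trans_le (le_csSup hbdd hs)
  refine ⟨sSup T, hr0, ?_, ?_⟩
  · by_contra hlt
    obtain ⟨r', _, hr', hr''⟩ := exists_lt_measure_closedBall U hr0 (not_le.1 hlt)
    obtain ⟨r, hrT, hr⟩ := exists_lt_of_lt_csSup ⟨s, hs⟩ hr'
    exact absurd ((measure_mono (closedBall_subset_closedBall hr.le)).trans hrT.2) (not_le.2 hr'')
  · refine ge_of_tendsto (htend (sSup T)) ?_
    filter_upwards [self_mem_nhdsWithin] with r hr
    by_contra hlt
    exact absurd (le_csSup hbdd ⟨hr0.trans hr, (not_le.1 hlt).le⟩) (not_le.2 hr)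

/-- The weak type bound for centered maximal functions of one measure with respect to another. -/
theorem exists_centered_maximal_weak_type [SecondCountableTopology E] [HasBesicovitchCovering E] :
    ∃ N : ℕ, ∀ (U μ : Measure E) (s : ℝ≥0∞),
      s * U {x | ∃ r, 0 < r ∧ s * U (closedBall x r) ≤ μ (closedBall x r)} ≤ N * μ univ := by
  obtain ⟨N, τ, hτ, hN⟩ := HasBesicovitchCovering.no_satelliteConfig (α := E)
  refine ⟨N, fun U μ s => ?_⟩
  -- Besicovitch's theorem needs bounded radii; the bound `R` is removed by monotone union.
  set A : ℕ → Set E := fun R =>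
    {x | ∃ r : ℝ, 0 < r ∧ r ≤ R ∧ s * U (closedBall x r) ≤ μ (closedBall x r)} with hA
  have hAU : {x | ∃ r, 0 < r ∧ s * U (closedBall x r) ≤ μ (closedBall x r)} = ⋃ R, A R := by
    ext x
    simp only [hA, mem_iUnion, mem_ofPred_eq]
    constructor
    · rintro ⟨r, h0, h⟩
      obtain ⟨R, hR⟩ := exists_nat_ge r
      exact ⟨R, r, h0, hR, h⟩
    · rintro ⟨R, r, h0, _, h⟩
      exact ⟨r, h0, h⟩
  have hmono : Monotone A := by
    rintro a b hab x ⟨r, h0, h1, h2⟩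
    exact ⟨r, h0, h1.trans (by exact_mod_cast hab), h2⟩
  rw [hAU, hmono.measure_iUnion, ENNReal.mul_iSup]
  refine iSup_le fun R => ?_
  have hch : ∀ x : A R, ∃ r : ℝ, 0 < r ∧ r ≤ R ∧ s * U (closedBall (x : E) r) ≤ μ (closedBall x r) :=
    fun x => x.2
  choose r hr0 hrR hr using hch
  let q : Besicovitch.BallPackage (A R) E :=
    { c := fun x => x, r := r, rpos := hr0, r_bound := R, r_le := hrR }
  obtain ⟨t, htd, htc⟩ := Besicovitch.exist_disjoint_covering_families hτ hN q
  have hcount : ∀ i, (t i).Countable := fun i =>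
    (htd i).countable_of_nonempty_interior fun x _ =>
      ⟨x, ball_subset_interior_closedBall (mem_ball_self (hr0 x))⟩
  have hsub : A R ⊆ ⋃ i : Fin N, ⋃ j ∈ t i, closedBall (j : E) (r j) := by
    intro x hx
    have := htc ⟨⟨x, hx⟩, rfl⟩
    simp only [mem_iUnion] at this ⊢
    obtain ⟨i, j, hj, h⟩ := this
    exact ⟨i, j, hj, ball_subset_closedBall h⟩
  calc s * U (A R) ≤ s * ∑ i : Fin N, ∑' j : t i, U (closedBall (j : E) (r j)) := by
        gcongr
        refine (measure_mono hsub).trans ((measure_iUnion_fintype_le _ _).trans ?_)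
        gcongr with i
        exact measure_biUnion_le _ (hcount i) _
    _ = ∑ i : Fin N, ∑' j : t i, s * U (closedBall (j : E) (r j)) := by
        rw [Finset.mul_sum]
        simp_rw [ENNReal.tsum_mul_left]
    _ ≤ ∑ i : Fin N, ∑' j : t i, μ (closedBall (j : E) (r j)) := by
        gcongr with i _ j
        exact hr j
    _ ≤ ∑ i : Fin N, μ univ := by
        gcongr with i
        rw [← measure_biUnion (hcount i) (htd i) fun j _ => isClosed_closedBall.measurableSet]
        exact measure_mono (subset_univ _)
    _ = N * μ univ := by simp

/-- Hedberg's pointwise estimate: if the averages of `f ^ p dS` with respect to `U` over balls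
centred at `x` are at most `N`, then the potential of `f` at `x` is controlled by `N`. -/
theorem lintegral_mul_kernel_le_of_ball_averages_le [ProperSpace E] {p p' q : ℝ}
    (hp : p.HolderConjugate p')
    (hpq : p < q) (S U : Measure E) [IsFiniteMeasureOnCompacts U] {x : E}
    (hSx : S {x} = 0) (hUx : U {x} = 0) (hUpos : ∀ r, 0 < r → U (ball x r) ≠ 0)
    {k : E → ℝ≥0∞} (hk : Measurable k) {A : ℝ≥0∞}
    (hA : ∀ r, 0 < r → (∫⁻ y in (ball x r)ᶜ, k y ^ p' ∂S) ^ (1 / p') *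
      U (closedBall x r) ^ (1 / q) ≤ A)
    {f : E → ℝ≥0∞} (hf : Measurable f) (hm0 : ∫⁻ y, f y ^ p ∂S ≠ 0)
    (hm : ∫⁻ y, f y ^ p ∂S ≠ ∞) {N : ℝ≥0∞} (hN0 : N ≠ 0) (hN : N ≠ ∞)
    (hfN : ∀ r, 0 < r → ∫⁻ y in ball x r, f y ^ p ∂S ≤ N * U (ball x r)) :
    ∫⁻ y, f y * k y ∂S ≤ A * (2 ^ (1 / q) * (1 + (1 - 2 ^ (-(1 / p - 1 / q)))⁻¹)) *
      (N ^ (1 / q) * (∫⁻ y, f y ^ p ∂S) ^ (1 / p - 1 / q)) := by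
  have hp0 := hp.pos
  have hp0' := hp.symm.pos
  have hq0 : 0 < q := hp0.trans hpq
  set m := ∫⁻ y, f y ^ p ∂S with hmdef
  set δ : ℝ := 1 / p - 1 / q with hδ
  have hδ0 : 0 < δ := by
    rw [hδ]; exact sub_pos.2 (one_div_lt_one_div_of_lt hp0 hpq)
  -- The critical mass is `m / N`. Letting the balls grow in `hfN` gives `m ≤ N * U univ`; halving
  -- makes the inequality `V < U univ` strict, as needed to choose radii.
  set V : ℝ≥0∞ := m / N / 2 with hV
  have hmN0 : m / N ≠ 0 := ENNReal.div_ne_zero.2 ⟨hm0, hN⟩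
  have hmN : m / N ≠ ∞ := ENNReal.div_ne_top hm hN0
  have hV0 : V ≠ 0 := ENNReal.div_ne_zero.2 ⟨hmN0, by norm_num⟩
  have hVt : V ≠ ∞ := ENNReal.div_ne_top hmN (by norm_num)
  have hVU : V < U univ := by
    refine (ENNReal.half_lt_self hmN0 hmN).trans_le ?_
    rw [ENNReal.div_le_iff hN0 hN, mul_comm]
    have hmono : Monotone fun n : ℕ => ball x (n : ℝ) := fun a b hab =>
      ball_subset_ball (by exact_mod_cast hab)
    rw [hmdef, ← setLIntegral_univ, ← iUnion_ball_nat x,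
      setLIntegral_iUnion_of_directed _ hmono.directed_le]
    refine iSup_le fun n => ?_
    rcases Nat.eq_zero_or_pos n with rfl | hn
    · simp
    · refine (hfN n (by exact_mod_cast hn)).trans ?_
      gcongr
      exact subset_iUnion (fun n : ℕ => ball x (n : ℝ)) n
  set v : ℕ → ℝ≥0∞ := fun j => V * (2 : ℝ≥0∞)⁻¹ ^ j with hv
  have hv0 : ∀ j, v j ≠ 0 := fun j => mul_ne_zero hV0 (by simp)
  have hvt : ∀ j, v j ≠ ∞ := fun j => ENNReal.mul_ne_top hVt (by simp)
  have hvU : ∀ j, v j < U univ := fun j => by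
    refine lt_of_le_of_lt ?_ hVU
    exact mul_le_of_le_one_right' (pow_le_one₀ bot_le (by simp))
  choose r hr0 hr1 hr2 using fun j => exists_radius_measure_ball_le U x hUx (hv0 j) (hvU j)
  -- A point `y ≠ x` in all the balls would force the ball of radius `dist y x` about `x` to be
  -- `U`-null, against `hUpos`.
  have hcover : ∀ y, y ≠ x → y ∈ (ball x (r 0))ᶜ ∪ ⋃ j, ball x (r j) \ ball x (r (j + 1)) := by
    intro y hy
    have hex : ∃ j, y ∉ ball x (r j) := by
      have hd : 0 < dist y x := dist_pos.2 hy
      have hlim : Filter.Tendsto v Filter.atTop (nhds 0) := by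
        have := ENNReal.Tendsto.const_mul
          (ENNReal.tendsto_pow_atTop_nhds_zero_of_lt_one (r := (2 : ℝ≥0∞)⁻¹) (by norm_num))
          (Or.inr hVt)
        simpa using this
      obtain ⟨j, hj⟩ := (hlim.eventually (gt_mem_nhds (pos_iff_ne_zero.2 (hUpos _ hd)))).exists
      refine ⟨j, fun hmem => ?_⟩
      have : U (ball x (dist y x)) ≤ v j :=
        (measure_mono (ball_subset_ball (mem_ball.1 hmem).le)).trans (hr1 j)
      exact absurd hj (not_lt.2 this)
    classical
    rcases hfind : Nat.find hex with _ | j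
    · have := Nat.find_spec hex
      rw [hfind] at this
      exact Or.inl this
    · have h1 := Nat.find_spec hex
      rw [hfind] at h1
      have h2 := not_not.1 (Nat.find_min hex (m := j) (by omega))
      exact Or.inr (mem_iUnion.2 ⟨j, h2, h1⟩)
  have hK : ∀ j, (∫⁻ y in (ball x (r j))ᶜ, k y ^ p' ∂S) ^ (1 / p') ≤ A * v j ^ (-(1 / q)) := by
    intro j
    have h1 : v j ^ (1 / q) ≠ 0 := by simp [ENNReal.rpow_eq_zero_iff, hv0 j, hvt j]
    have h2 : v j ^ (1 / q) ≠ ∞ := by simp [ENNReal.rpow_eq_top_iff, hv0 j, hvt j]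
    rw [ENNReal.rpow_neg, ← div_eq_mul_inv, ENNReal.le_div_iff_mul_le (Or.inl h1) (Or.inl h2)]
    refine le_trans ?_ (hA (r j) (hr0 j))
    gcongr
    exact hr2 j
  have hHol : ∀ s : Set E, ∫⁻ y in s, f y * k y ∂S ≤
      (∫⁻ y in s, f y ^ p ∂S) ^ (1 / p) * (∫⁻ y in s, k y ^ p' ∂S) ^ (1 / p') := fun s =>
    ENNReal.lintegral_mul_le_Lp_mul_Lq (S.restrict s) hp hf.aemeasurable hk.aemeasurable
  have e1 : (0 : ℝ) ≤ 1 / p := by positivity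
  have e2 : (0 : ℝ) ≤ 1 / p' := by positivity
  have e3 : (0 : ℝ) ≤ 1 / q := by positivity
  have hVq : V ^ (-(1 / q)) = 2 ^ (1 / q) * (N ^ (1 / q) * m ^ (-(1 / q))) := by
    rw [hV, div_eq_mul_inv, div_eq_mul_inv, ENNReal.mul_rpow_of_ne_top (by finiteness) (by simp),
      ENNReal.mul_rpow_of_ne_top hm (by finiteness), ENNReal.inv_rpow, ENNReal.inv_rpow,
      ← ENNReal.rpow_neg, ← ENNReal.rpow_neg, neg_neg]
    ring
  have hVδ : N ^ (1 / p) * V ^ δ ≤ N ^ (1 / q) * m ^ δ := by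
    calc N ^ (1 / p) * V ^ δ ≤ N ^ (1 / p) * (m / N) ^ δ := by
          gcongr
          exact ENNReal.half_le_self
      _ = N ^ (1 / p + -δ) * m ^ δ := by
          rw [div_eq_mul_inv m, ENNReal.mul_rpow_of_ne_top hm (by finiteness), ENNReal.inv_rpow,
            ← ENNReal.rpow_neg, ENNReal.rpow_add _ _ hN0 hN]
          ring
      _ = _ := by congr 2; rw [hδ]; ring
  have hfirst : ∫⁻ y in (ball x (r 0))ᶜ, f y * k y ∂S ≤ A * 2 ^ (1 / q) * (N ^ (1 / q) * m ^ δ) := by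
    calc ∫⁻ y in (ball x (r 0))ᶜ, f y * k y ∂S ≤ m ^ (1 / p) * (A * v 0 ^ (-(1 / q))) := by
          refine (hHol _).trans ?_
          gcongr
          · exact setLIntegral_le_lintegral _ _
          · exact hK 0
      _ = A * 2 ^ (1 / q) * (N ^ (1 / q) * (m ^ (1 / p) * m ^ (-(1 / q)))) := by
          simp only [hv, pow_zero, mul_one]
          rw [hVq]; ring
      _ = _ := by rw [← ENNReal.rpow_add _ _ hm0 hm, hδ, sub_eq_add_neg]
  -- Hölder on one ring: `f ^ p` has mass at most `N * v j` in the outer ball, and the kernel is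
  -- estimated off the inner one. What remains is `v j ^ δ` up to constants, geometrically small
  -- because `p < q` makes `δ` positive.
  have hring : ∀ j, ∫⁻ y in ball x (r j) \ ball x (r (j + 1)), f y * k y ∂S ≤
      A * 2 ^ (1 / q) * (N ^ (1 / q) * m ^ δ) * ((2 : ℝ≥0∞) ^ (-δ)) ^ j := by
    intro j
    have hpw : (v j) ^ (1 / p) * v (j + 1) ^ (-(1 / q)) =
        2 ^ (1 / q) * V ^ δ * ((2 : ℝ≥0∞) ^ (-δ)) ^ j := by
      have hvj : v (j + 1) = v j * 2⁻¹ := by simp only [hv]; rw [pow_succ, mul_assoc]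
      rw [hvj, ENNReal.mul_rpow_of_ne_top (hvt j) (by simp), ENNReal.inv_rpow, ← ENNReal.rpow_neg,
        neg_neg, ← mul_assoc, ← ENNReal.rpow_add _ _ (hv0 j) (hvt j), ← sub_eq_add_neg, ← hδ]
      simp only [hv]
      rw [ENNReal.mul_rpow_of_ne_top hVt (by simp), ← ENNReal.rpow_natCast, ← ENNReal.rpow_natCast,
        ENNReal.inv_rpow, ← ENNReal.rpow_neg, ← ENNReal.rpow_mul, ← ENNReal.rpow_mul,
        show -(j : ℝ) * δ = -δ * j by ring]
      ring
    calc ∫⁻ y in ball x (r j) \ ball x (r (j + 1)), f y * k y ∂S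
        ≤ (N * v j) ^ (1 / p) * (A * v (j + 1) ^ (-(1 / q))) := by
          refine (hHol _).trans ?_
          gcongr
          · refine (lintegral_mono_set sdiff_subset).trans ((hfN _ (hr0 j)).trans ?_)
            gcongr
            exact hr1 j
          · refine le_trans ?_ (hK (j + 1))
            gcongr
            exact fun y hy => hy.2
      _ = A * N ^ (1 / p) * ((v j) ^ (1 / p) * v (j + 1) ^ (-(1 / q))) := by
          rw [ENNReal.mul_rpow_of_nonneg _ _ e1]; ring
      _ = A * 2 ^ (1 / q) * (N ^ (1 / p) * V ^ δ) * ((2 : ℝ≥0∞) ^ (-δ)) ^ j := by rw [hpw]; ring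
      _ ≤ _ := by gcongr
  calc ∫⁻ y, f y * k y ∂S = ∫⁻ y in {x}ᶜ, f y * k y ∂S := by
        rw [Measure.restrict_eq_self_of_ae_mem]
        exact compl_mem_ae_iff.2 hSx
    _ ≤ ∫⁻ y in (ball x (r 0))ᶜ ∪ ⋃ j, ball x (r j) \ ball x (r (j + 1)), f y * k y ∂S :=
        lintegral_mono_set fun y hy => hcover y hy
    _ ≤ ∫⁻ y in (ball x (r 0))ᶜ, f y * k y ∂S +
          ∑' j, ∫⁻ y in ball x (r j) \ ball x (r (j + 1)), f y * k y ∂S :=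
        (lintegral_union_le _ _ _).trans (add_le_add le_rfl (lintegral_iUnion_le _ _))
    _ ≤ A * 2 ^ (1 / q) * (N ^ (1 / q) * m ^ δ) +
          ∑' j, A * 2 ^ (1 / q) * (N ^ (1 / q) * m ^ δ) * ((2 : ℝ≥0∞) ^ (-δ)) ^ j :=
        add_le_add hfirst (ENNReal.tsum_le_tsum hring)
    _ = _ := by
        rw [ENNReal.tsum_mul_left, ENNReal.tsum_geometric]; ring

/-- The off-diagonal weak type inequality for a positive kernel, from a global testing condition. -/
theorem exists_kernel_weak_type [ProperSpace E] [SecondCountableTopology E]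
    [HasBesicovitchCovering E] {p p' q : ℝ} (hp : p.HolderConjugate p') (hpq : p < q)
    (S U : Measure E) [IsFiniteMeasureOnCompacts U]
    (hS : ∀ x, S {x} = 0) (hU : ∀ x, U {x} = 0)
    {k : E → E → ℝ≥0∞} (hk : ∀ x, Measurable (k x)) {A : ℝ≥0∞} (hAt : A ≠ ∞)
    (hA : ∀ x r, 0 < r → (∫⁻ y in (ball x r)ᶜ, k x y ^ p' ∂S) ^ (1 / p') *
      U (closedBall x r) ^ (1 / q) ≤ A) :
    ∃ C : ℝ≥0, ∀ f : E → ℝ≥0∞, Measurable f → ∫⁻ y, f y ^ p ∂S ≠ ∞ → ∀ t : ℝ≥0∞, t ≠ 0 → t ≠ ∞ →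
      t * U {x | t < ∫⁻ y, f y * k x y ∂S} ^ (1 / q) ≤ C * (∫⁻ y, f y ^ p ∂S) ^ (1 / p) := by
  obtain ⟨B, hB⟩ := exists_centered_maximal_weak_type (E := E)
  have hp0 := hp.pos
  have hq0 : 0 < q := hp0.trans hpq
  set δ : ℝ := 1 / p - 1 / q with hδ
  have hδ0 : 0 < δ := by
    rw [hδ]; exact sub_pos.2 (one_div_lt_one_div_of_lt hp0 hpq)
  have hc1 : (2 : ℝ≥0∞) ^ (-δ) < 1 :=
    ENNReal.rpow_lt_one_of_one_lt_of_neg (by norm_num) (by linarith)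
  have hcfin : (1 - (2 : ℝ≥0∞) ^ (-δ))⁻¹ ≠ ∞ := by
    simpa [ENNReal.inv_eq_top, tsub_eq_zero_iff_le] using hc1
  -- `A + 1` in place of `A` keeps `c` nonzero, so that it can be divided by.
  set c : ℝ≥0∞ := (A + 1) * (2 ^ (1 / q) * (1 + (1 - 2 ^ (-δ))⁻¹)) with hc
  have hct : c ≠ ∞ := by
    have : (2 : ℝ≥0∞) ^ (1 / q) ≠ ∞ := ENNReal.rpow_ne_top_of_nonneg (by positivity) (by norm_num)
    finiteness
  have hc0 : c ≠ 0 := by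
    have : (2 : ℝ≥0∞) ^ (1 / q) ≠ 0 := by simp
    simp [hc]
  have hCt : c * (B : ℝ≥0∞) ^ (1 / q) ≠ ∞ :=
    ENNReal.mul_ne_top hct (ENNReal.rpow_ne_top_of_nonneg (by positivity) (by simp))
  refine ⟨(c * (B : ℝ≥0∞) ^ (1 / q)).toNNReal, fun f hf hm t ht0 ht => ?_⟩
  rw [ENNReal.coe_toNNReal hCt]
  set m := ∫⁻ y, f y ^ p ∂S with hmdef
  rcases eq_or_ne m 0 with hm0 | hm0
  · have hf0 : f =ᵐ[S] 0 := by
      rw [hmdef, lintegral_eq_zero_iff (hf.pow_const _)] at hm0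
      filter_upwards [hm0] with y hy
      simpa [hp0, hp0.le, hp0.not_gt, ENNReal.rpow_eq_zero_iff] using hy
    have : ∀ x, ∫⁻ y, f y * k x y ∂S = 0 := fun x => by
      rw [lintegral_congr_ae (g := fun _ => 0)]
      · simp
      · filter_upwards [hf0] with y hy
        simp [hy]
    simp [this, hq0]
  have hmδ0 : m ^ δ ≠ 0 := by simp [ENNReal.rpow_eq_zero_iff, hm0, hm]
  have hmδ : m ^ δ ≠ ∞ := by simp [ENNReal.rpow_eq_top_iff, hm0, hm]
  -- The level of averages at which Hedberg's bound equals exactly `t`; see `htN`.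
  set N : ℝ≥0∞ := (t / (c * m ^ δ)) ^ q with hN
  have hd0 : t / (c * m ^ δ) ≠ 0 := ENNReal.div_ne_zero.2 ⟨ht0, ENNReal.mul_ne_top hct hmδ⟩
  have hdt : t / (c * m ^ δ) ≠ ∞ := ENNReal.div_ne_top ht (mul_ne_zero hc0 hmδ0)
  have hN0 : N ≠ 0 := by simp [hN, ENNReal.rpow_eq_zero_iff, hd0, hdt]
  have hNt : N ≠ ∞ := by simp [hN, ENNReal.rpow_eq_top_iff, hd0, hdt]
  have htN : t = c * (N ^ (1 / q) * m ^ δ) := by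
    rw [hN, ← ENNReal.rpow_mul, mul_one_div_cancel hq0.ne', ENNReal.rpow_one, mul_left_comm,
      ENNReal.div_mul_cancel (mul_ne_zero hc0 hmδ0) (ENNReal.mul_ne_top hct hmδ)]
  set μ : Measure E := S.withDensity fun y => f y ^ p with hμ
  -- Points outside the support of `U`, where Hedberg's estimate does not apply, form a null set by
  -- second countability.
  have hnull : U {x | ∃ r, 0 < r ∧ U (ball x r) = 0} = 0 := by
    refine measure_null_of_locally_null _ fun x hx => ?_
    obtain ⟨r, hr, h⟩ := hx
    exact ⟨ball x r, mem_nhdsWithin_of_mem_nhds (ball_mem_nhds x hr), h⟩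
  have hsub : {x | t < ∫⁻ y, f y * k x y ∂S} ⊆ {x | ∃ r, 0 < r ∧ U (ball x r) = 0} ∪
      {x | ∃ r, 0 < r ∧ N * U (closedBall x r) ≤ μ (closedBall x r)} := by
    intro x hx
    by_contra hcon
    simp only [mem_union, mem_ofPred_eq, not_or, not_exists, not_and, not_le] at hcon
    have hx' : t < ∫⁻ y, f y * k x y ∂S := hx
    refine absurd hx' (not_lt.2 ?_)
    refine (lintegral_mul_kernel_le_of_ball_averages_le hp hpq S U (hS x) (hU x) hcon.1 (hk x)
      (hA x) hf hm0 hm hN0 hNt fun r hr => ?_).trans ?_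
    -- The averages are controlled on closed balls; an open ball violating the bound would contain a
    -- smaller closed ball violating it too.
    · by_contra hlt
      rw [not_le, ← withDensity_apply _ measurableSet_ball] at hlt
      obtain ⟨s, hs0, hsr, hs⟩ := exists_lt_measure_closedBall _ hr hlt
      refine absurd (hcon.2 s hs0) (not_lt.2 (le_trans ?_ hs.le))
      gcongr
      exact closedBall_subset_ball hsr
    · conv_rhs => rw [htN]
      gcongr
      rw [hc]
      gcongr
      exact le_self_add
  have hμm : μ univ = m := by rw [hμ, withDensity_apply _ MeasurableSet.univ, setLIntegral_univ]
  have hfin : N * U {x | t < ∫⁻ y, f y * k x y ∂S} ≤ B * m := by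
    rw [← hμm]
    refine le_trans ?_ (hB U μ N)
    gcongr N * ?_
    refine (measure_mono hsub).trans ((measure_union_le _ _).trans ?_)
    rw [hnull, zero_add]
  generalize U {x | t < ∫⁻ y, f y * k x y ∂S} = u at hfin ⊢
  calc t * u ^ (1 / q) = c * (N ^ (1 / q) * m ^ δ) * u ^ (1 / q) := by rw [← htN]
    _ = c * m ^ δ * (N * u) ^ (1 / q) := by
        rw [ENNReal.mul_rpow_of_nonneg _ _ (by positivity)]; ring
    _ ≤ c * m ^ δ * (B * m) ^ (1 / q) := by gcongr
    _ = c * (B : ℝ≥0∞) ^ (1 / q) * (m ^ δ * m ^ (1 / q)) := by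
        rw [ENNReal.mul_rpow_of_nonneg _ _ (by positivity)]; ring
    _ = _ := by rw [← ENNReal.rpow_add _ _ hm0 hm, hδ, sub_add_cancel]

end Hedberg

/-! ### Dyadic grids and the dyadic model of the kernel -/

section Dyadic

variable {n : ℕ}

/-- The half-open dyadic cube of generation `k` and index `m`, in the grid translated by `τ`. -/
def dyadicCube (τ : EuclideanSpace ℝ (Fin n)) (i : ℤ × (Fin n → ℤ)) :
    Set (EuclideanSpace ℝ (Fin n)) :=
  {x | ∀ j, ⌊(x j - τ j) / 2 ^ i.1⌋ = i.2 j}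

theorem measurableSet_dyadicCube (τ : EuclideanSpace ℝ (Fin n)) (i : ℤ × (Fin n → ℤ)) :
    MeasurableSet (dyadicCube τ i) := by
  have : dyadicCube τ i = ⋂ j, {x | ⌊(x j - τ j) / 2 ^ i.1⌋ = i.2 j} := by
    ext x; simp [dyadicCube]
  rw [this]
  refine MeasurableSet.iInter fun j => ?_
  have hm : Measurable fun x : EuclideanSpace ℝ (Fin n) => ⌊(x j - τ j) / 2 ^ i.1⌋ := by
    fun_prop
  exact hm (measurableSet_singleton (i.2 j))

/-- `⌊y / 2 ^ (k + d)⌋` is the integer quotient of `⌊y / 2 ^ k⌋` by `2 ^ d`, so the index of a point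
at a fine scale determines its index at every coarser one. -/
theorem dyadicCube_subset_of_le {τ : EuclideanSpace ℝ (Fin n)} {i i' : ℤ × (Fin n → ℤ)}
    (h : i.1 ≤ i'.1) : dyadicCube τ i ⊆ dyadicCube τ i' ∨
      Disjoint (dyadicCube τ i) (dyadicCube τ i') := by
  obtain ⟨d, hd⟩ := Int.le.dest h
  have key : ∀ y : ℝ, ⌊y / 2 ^ i'.1⌋ = ⌊y / 2 ^ i.1⌋ / ((2 ^ d : ℕ) : ℤ) := by
    intro y
    rw [← Int.floor_div_natCast, ← hd, zpow_add₀ (by norm_num), div_div]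
    simp
  by_cases hdis : Disjoint (dyadicCube τ i) (dyadicCube τ i')
  · exact Or.inr hdis
  · left
    obtain ⟨z, hz, hz'⟩ := Set.not_disjoint_iff.1 hdis
    intro x hx j
    rw [key, hx j, ← hz j, ← key, hz' j]

theorem dyadicCube_laminar (τ : EuclideanSpace ℝ (Fin n)) (i i' : ℤ × (Fin n → ℤ)) :
    dyadicCube τ i ⊆ dyadicCube τ i' ∨ dyadicCube τ i' ⊆ dyadicCube τ i ∨
      Disjoint (dyadicCube τ i) (dyadicCube τ i') := by
  rcases le_total i.1 i'.1 with h | h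
  · rcases dyadicCube_subset_of_le (τ := τ) h with h | h
    · exact Or.inl h
    · exact Or.inr (Or.inr h)
  · rcases dyadicCube_subset_of_le (τ := τ) h with h | h
    · exact Or.inr (Or.inl h)
    · exact Or.inr (Or.inr h.symm)

theorem dist_le_of_forall_abs_sub_le {x y : EuclideanSpace ℝ (Fin n)} {c : ℝ} (hc : 0 ≤ c)
    (h : ∀ j, |x j - y j| ≤ c) : dist x y ≤ √n * c := by
  rw [EuclideanSpace.dist_eq, ← Real.sqrt_sq hc, ← Real.sqrt_mul (by positivity)]
  refine Real.sqrt_le_sqrt ?_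
  calc ∑ j, dist (x j) (y j) ^ 2 ≤ ∑ _j : Fin n, c ^ 2 := by
        refine Finset.sum_le_sum fun j _ => ?_
        rw [Real.dist_eq]
        exact pow_le_pow_left₀ (abs_nonneg _) (h j) 2
    _ = n * c ^ 2 := by simp

theorem dist_le_of_mem_dyadicCube {τ x y : EuclideanSpace ℝ (Fin n)} {i : ℤ × (Fin n → ℤ)}
    (hx : x ∈ dyadicCube τ i) (hy : y ∈ dyadicCube τ i) : dist x y ≤ √n * 2 ^ i.1 := by
  refine dist_le_of_forall_abs_sub_le (by positivity) fun j => ?_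
  have h2 : (0 : ℝ) < 2 ^ i.1 := by positivity
  have h := Int.abs_sub_lt_one_of_floor_eq_floor ((hx j).trans (hy j).symm)
  rw [← sub_div, abs_div, abs_of_pos h2, div_lt_one h2] at h
  simpa using h.le

theorem measure_dyadicCube_ne_top (μ : Measure (EuclideanSpace ℝ (Fin n)))
    [IsLocallyFiniteMeasure μ] (τ : EuclideanSpace ℝ (Fin n)) (i : ℤ × (Fin n → ℤ)) :
    μ (dyadicCube τ i) ≠ ∞ := by
  rcases (dyadicCube τ i).eq_empty_or_nonempty with h | ⟨x, hx⟩
  · simp [h]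
  · refine ne_top_of_le_ne_top
      (isCompact_closedBall x (√n * 2 ^ i.1)).measure_lt_top.ne (measure_mono fun y hy => ?_)
    exact dist_le_of_mem_dyadicCube hy hx

/-- The one-third trick. In units of `2 ^ k` the shift is `2 ^ d / 3` with `d = K - k`, never an
integer as `3` does not divide `2 ^ d`. Endpoints of the two grids are therefore at least `1 / 3`
apart, and a shorter interval cannot cross one of each. -/
theorem floor_eq_floor_or_of_abs_sub_lt {x y : ℝ} {k K : ℤ} (hkK : k ≤ K)
    (h : 3 * |x - y| < 2 ^ k) : ⌊x / 2 ^ k⌋ = ⌊y / 2 ^ k⌋ ∨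
      ⌊(x - 2 ^ K / 3) / 2 ^ k⌋ = ⌊(y - 2 ^ K / 3) / 2 ^ k⌋ := by
  wlog hxy : x ≤ y generalizing x y
  · rw [abs_sub_comm] at h
    exact (this h (le_of_not_ge hxy)).imp Eq.symm Eq.symm
  obtain ⟨d, rfl⟩ := Int.le.dest hkK
  have h2 : (0 : ℝ) < 2 ^ k := by positivity
  by_contra! hcon
  have hshift : ∀ z : ℝ, (z - 2 ^ (k + (d : ℤ)) / 3) / 2 ^ k = z / 2 ^ k - 2 ^ d / 3 := by
    intro z
    rw [zpow_add₀ (by norm_num), zpow_natCast]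
    field_simp
  rw [hshift, hshift] at hcon
  have hXY : y / 2 ^ k - x / 2 ^ k < 1 / 3 := by
    rw [← sub_div, div_lt_iff₀ h2]
    rw [abs_sub_comm, abs_of_nonneg (sub_nonneg.2 hxy)] at h
    linarith
  have hle : x / 2 ^ k ≤ y / 2 ^ k := by gcongr
  generalize x / 2 ^ k = X at *
  generalize y / 2 ^ k = Y at *
  have h1 : ⌊X⌋ < ⌊Y⌋ := lt_of_le_of_ne (Int.floor_mono hle) hcon.1
  have h3 : ⌊X - 2 ^ d / 3⌋ < ⌊Y - 2 ^ d / 3⌋ :=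
    lt_of_le_of_ne (Int.floor_mono (by linarith)) hcon.2
  set a := ⌊Y⌋
  set b := ⌊Y - 2 ^ d / 3⌋
  have ha1 : X < a := Int.floor_lt.1 h1
  have ha2 : (a : ℝ) ≤ Y := Int.floor_le _
  have hb1 : X - 2 ^ d / 3 < b := Int.floor_lt.1 h3
  have hb2 : (b : ℝ) ≤ Y - 2 ^ d / 3 := Int.floor_le _
  have c1 : (3 * (b - a) + 2 ^ d : ℝ) < 1 := by linarith
  have c2 : (-1 : ℝ) < 3 * (b - a) + 2 ^ d := by linarith
  have c1' : 3 * (b - a) + 2 ^ d < (1 : ℤ) := by exact_mod_cast c1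
  have c2' : (-1 : ℤ) < 3 * (b - a) + 2 ^ d := by exact_mod_cast c2
  have hdvd : (3 : ℤ) ∣ 2 ^ d := ⟨a - b, by omega⟩
  have := Int.Prime.dvd_pow' (by norm_num : Nat.Prime 3) hdvd
  omega

theorem ofReal_two_zpow (k : ℤ) : ENNReal.ofReal ((2 : ℝ) ^ k) = (2 : ℝ≥0∞) ^ k := by
  rw [← Real.rpow_intCast, ← ENNReal.ofReal_rpow_of_pos (by norm_num), ENNReal.rpow_intCast]
  simp

/-- Translations of the dyadic grid by thirds of the coarse scale `2 ^ K`. -/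
noncomputable def gridShift (K : ℕ) (t : Fin n → Bool) : EuclideanSpace ℝ (Fin n) :=
  WithLp.toLp 2 fun j => if t j then 2 ^ (K : ℤ) / 3 else 0

/-- The weight attached to a dyadic cube of side `2 ^ k` by a kernel of degree `-β`. -/
noncomputable def dyadicWeight (β : ℝ) (i : ℤ × (Fin n → ℤ)) : ℝ≥0∞ := ((2 : ℝ≥0∞) ^ i.1) ^ (-β)

/-- The dyadic model of the kernel `edist x y ^ (-β)` on the grid translated by `τ`. -/
noncomputable def dyadicKernel (β : ℝ) (τ x y : EuclideanSpace ℝ (Fin n)) : ℝ≥0∞ :=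
  ∑' i, dyadicWeight β i * ((dyadicCube τ i).indicator 1 x * (dyadicCube τ i).indicator 1 y)

/-- Choosing the shift separately in each coordinate puts `x` and `y` in one cube of side `2 ^ (l +
1)`, where `2 ^ l ≤ 3 * dist x y < 2 ^ (l + 1)`. The side is at most `6 * dist x y`, so this single
term suffices. The shift works only for scales up to `2 ^ K`, hence `K₀` depends on the pair. -/
theorem edist_rpow_le_dyadicKernel {β : ℝ} (hβ : 0 < β) {x y : EuclideanSpace ℝ (Fin n)}
    (hxy : x ≠ y) : ∃ K₀ : ℕ, ∀ K ≥ K₀,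
      edist x y ^ (-β) ≤ 6 ^ β * ∑ t : Fin n → Bool, dyadicKernel β (gridShift K t) x y := by
  have hD : 0 < dist x y := dist_pos.2 hxy
  obtain ⟨l, hl1, hl2⟩ := exists_mem_Ico_zpow (x := 3 * dist x y) (y := 2) (by positivity)
    (by norm_num)
  refine ⟨(l + 1).toNat, fun K hK => ?_⟩
  have hkK : l + 1 ≤ (K : ℤ) := by omega
  have hco : ∀ j, 3 * |x j - y j| < 2 ^ (l + 1) := fun j => by
    refine lt_of_le_of_lt ?_ hl2
    gcongr
    simpa [Real.dist_eq] using PiLp.dist_apply_le x y j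
  have hfl := fun j => floor_eq_floor_or_of_abs_sub_lt hkK (hco j)
  classical
  set t : Fin n → Bool := fun j => ! decide (⌊x j / 2 ^ (l + 1)⌋ = ⌊y j / 2 ^ (l + 1)⌋) with ht
  set i : ℤ × (Fin n → ℤ) := (l + 1, fun j => ⌊(y j - gridShift K t j) / 2 ^ (l + 1)⌋) with hi
  have hy : y ∈ dyadicCube (gridShift K t) i := fun j => rfl
  have hx : x ∈ dyadicCube (gridShift K t) i := fun j => by
    simp only [hi, gridShift, ht]
    by_cases h : ⌊x j / 2 ^ (l + 1)⌋ = ⌊y j / 2 ^ (l + 1)⌋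
    · simp [h]
    · simpa [h] using (hfl j).resolve_left h
  calc edist x y ^ (-β) ≤ 6 ^ β * dyadicWeight β i := by
        have h6 : (2 : ℝ≥0∞) ^ (l + 1) ≤ 6 * edist x y := by
          have : (2 : ℝ) ^ (l + 1) ≤ 6 * dist x y := by
            rw [zpow_add_one₀ (by norm_num)]; linarith
          have h := ENNReal.ofReal_le_ofReal this
          rw [ENNReal.ofReal_mul (by norm_num), ← edist_dist] at h
          rw [ofReal_two_zpow] at h
          simpa using h
        have h7 := ENNReal.rpow_le_rpow h6 hβ.le
        simp only [dyadicWeight, hi]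
        rw [ENNReal.rpow_neg, ENNReal.rpow_neg, ← div_eq_mul_inv,
          ENNReal.le_div_iff_mul_le (Or.inr ?_) (Or.inr ?_)]
        · have hd0 : edist x y ^ β ≠ 0 := by
            simp [ENNReal.rpow_eq_zero_iff, edist_ne_top, hβ.not_gt, hxy]
          have hdt : edist x y ^ β ≠ ∞ := ENNReal.rpow_ne_top_of_nonneg hβ.le (edist_ne_top _ _)
          calc (edist x y ^ β)⁻¹ * ((2 : ℝ≥0∞) ^ (l + 1)) ^ β
              ≤ (edist x y ^ β)⁻¹ * (6 * edist x y) ^ β := by gcongr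
            _ = 6 ^ β * ((edist x y ^ β)⁻¹ * edist x y ^ β) := by
                rw [ENNReal.mul_rpow_of_nonneg _ _ hβ.le]; ring
            _ = 6 ^ β := by rw [ENNReal.inv_mul_cancel hd0 hdt, mul_one]
        · simp
        · exact ENNReal.rpow_ne_top_of_nonneg hβ.le (by norm_num)
    _ ≤ 6 ^ β * ∑ t : Fin n → Bool, dyadicKernel β (gridShift K t) x y := by
        gcongr
        refine le_trans ?_ (Finset.single_le_sum (f := fun t => dyadicKernel β (gridShift K t) x y)
          (fun _ _ => bot_le) (Finset.mem_univ t))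
        refine le_trans ?_ (ENNReal.le_tsum i)
        simp [Set.indicator_of_mem hx, Set.indicator_of_mem hy]

/-- The converse comparison, valid on every grid: at most one cube per generation contains both
points, and its side is at least `dist x y / √n`, so the weights sum geometrically. -/
theorem exists_sum_dyadicWeight_le {β : ℝ} (hβ : 0 < β) : ∃ C : ℝ≥0,
    ∀ (s : Finset (ℤ × (Fin n → ℤ))) (τ x y : EuclideanSpace ℝ (Fin n)), x ≠ y →
      ∑ i ∈ s, dyadicWeight β i * ((dyadicCube τ i).indicator 1 x * (dyadicCube τ i).indicator 1 y) ≤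
        C * edist x y ^ (-β) := by
  classical
  obtain ⟨C, hC⟩ := exists_sum_zpow_rpow_le β hβ
  have hsn : ENNReal.ofReal √n ^ β ≠ ∞ := ENNReal.rpow_ne_top_of_nonneg hβ.le (by simp)
  refine ⟨C * (ENNReal.ofReal √n ^ β).toNNReal, fun s τ x y hxy => ?_⟩
  have hd0 : edist x y ≠ 0 := by simpa using hxy
  rw [ENNReal.coe_mul, ENNReal.coe_toNNReal hsn]
  set s' := s.filter (fun i => x ∈ dyadicCube τ i ∧ y ∈ dyadicCube τ i) with hs'
  have hinj : Set.InjOn (fun i : ℤ × (Fin n → ℤ) => -i.1) s' := by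
    intro i hi i' hi' h
    have h1 := (Finset.mem_filter.1 hi).2.1
    have h2 := (Finset.mem_filter.1 hi').2.1
    have h3 : i.1 = i'.1 := neg_injective h
    refine Prod.ext h3 (funext fun j => ?_)
    rw [← h1 j, ← h2 j, h3]
  have hle : ∀ i ∈ s', (2 : ℝ≥0∞) ^ (-i.1) ≤ ENNReal.ofReal √n * (edist x y)⁻¹ := by
    intro i hi
    have h := dist_le_of_mem_dyadicCube (Finset.mem_filter.1 hi).2.1 (Finset.mem_filter.1 hi).2.2
    have h := ENNReal.ofReal_le_ofReal h
    rw [ENNReal.ofReal_mul (by positivity), ← edist_dist, ofReal_two_zpow] at h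
    have h0 : (2 : ℝ≥0∞) ^ i.1 ≠ 0 := (ENNReal.zpow_pos (by norm_num) (by norm_num) _).ne'
    have ht : (2 : ℝ≥0∞) ^ i.1 ≠ ∞ := (ENNReal.zpow_lt_top (by norm_num) (by norm_num) _).ne
    rw [ENNReal.zpow_neg, ← div_eq_mul_inv, ENNReal.le_div_iff_mul_le (Or.inl hd0) (Or.inl (edist_ne_top x y)),
      mul_comm, ← div_eq_mul_inv, ENNReal.div_le_iff h0 ht]
    exact h
  calc ∑ i ∈ s, dyadicWeight β i *
        ((dyadicCube τ i).indicator 1 x * (dyadicCube τ i).indicator 1 y)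
      = ∑ i ∈ s', ((2 : ℝ≥0∞) ^ (-i.1)) ^ β := by
        rw [hs', Finset.sum_filter]
        refine Finset.sum_congr rfl fun i _ => ?_
        have : dyadicWeight β i = ((2 : ℝ≥0∞) ^ (-i.1)) ^ β := by
          rw [dyadicWeight, ENNReal.rpow_neg, ENNReal.zpow_neg, ENNReal.inv_rpow]
        by_cases hx : x ∈ dyadicCube τ i <;> by_cases hy : y ∈ dyadicCube τ i <;> simp [hx, hy, this]
    _ = ∑ j ∈ s'.image (fun i => -i.1) with (2 : ℝ≥0∞) ^ j ≤ ENNReal.ofReal √n * (edist x y)⁻¹,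
          ((2 : ℝ≥0∞) ^ j) ^ β := by
        rw [Finset.filter_true_of_mem, Finset.sum_image hinj]
        intro j hj
        obtain ⟨i, hi, rfl⟩ := Finset.mem_image.1 hj
        exact hle i hi
    _ ≤ C * (ENNReal.ofReal √n * (edist x y)⁻¹) ^ β := hC _ _
    _ = _ := by
        rw [ENNReal.mul_rpow_of_ne_top (by simp) (by simpa using hxy), ENNReal.inv_rpow, ← ENNReal.rpow_neg, mul_assoc]

end Dyadic

/-! ### From testing conditions to the strong type inequality -/

section Strong

variable {n : ℕ}

theorem measurable_edist_rpow (β : ℝ) :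
    Measurable fun z : EuclideanSpace ℝ (Fin n) × EuclideanSpace ℝ (Fin n) =>
      edist z.1 z.2 ^ (-β) :=
  (measurable_fst.edist measurable_snd).pow_const _

theorem measurable_edist_rpow_right (β : ℝ) (x : EuclideanSpace ℝ (Fin n)) :
    Measurable fun y => edist x y ^ (-β) :=
  (measurable_const.edist measurable_id).pow_const _

/-- A weak type inequality for the dual operator gives the testing condition on sets. -/
theorem exists_testing_of_dual_weak_type {β p p' q q' : ℝ} (hp : p.HolderConjugate p')
    (hq : q.HolderConjugate q') (S U : Measure (EuclideanSpace ℝ (Fin n))) [SigmaFinite S]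
    [SigmaFinite U]
    (hw : ∃ C : ℝ≥0, ∀ g : EuclideanSpace ℝ (Fin n) → ℝ≥0∞, Measurable g → ∫⁻ x, g x ^ q' ∂U ≠ ∞ →
      ∀ t : ℝ≥0∞, t ≠ 0 → t ≠ ∞ → t * S {y | t < ∫⁻ x, g x * edist y x ^ (-β) ∂U} ^ (1 / p') ≤
        C * (∫⁻ x, g x ^ q' ∂U) ^ (1 / q')) :
    ∃ C : ℝ≥0, ∀ F : Set (EuclideanSpace ℝ (Fin n)), S F ≠ ∞ →
      (∫⁻ x, (∫⁻ y in F, edist x y ^ (-β) ∂S) ^ q ∂U) ^ (1 / q) ≤ C * S F ^ (1 / p) := by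
  obtain ⟨C₁, hC₁⟩ := hw
  obtain ⟨C₂, hC₂⟩ := exists_setLIntegral_le_of_weak (X := EuclideanSpace ℝ (Fin n)) p' hp.symm.lt
  refine ⟨C₂ * C₁, fun F hF => ?_⟩
  -- Pairing with `g` and using Tonelli moves the potential onto `g`; Kolmogorov's inequality then
  -- bounds its integral over `F`.
  refine rpow_lintegral_le_of_forall_lintegral_mul_le U hq
    (measurable_edist_rpow β).lintegral_prod_right' fun g hg hgq => ?_
  have hm : Measurable fun y => ∫⁻ x, g x * edist y x ^ (-β) ∂U :=
    ((hg.comp measurable_snd).mul (measurable_edist_rpow β)).lintegral_prod_right'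
  calc ∫⁻ x, (∫⁻ y in F, edist x y ^ (-β) ∂S) * g x ∂U
      = ∫⁻ x, ∫⁻ y in F, g x * edist y x ^ (-β) ∂S ∂U := by
        refine lintegral_congr fun x => ?_
        rw [mul_comm, ← lintegral_const_mul _ (measurable_edist_rpow_right β x)]
        simp_rw [edist_comm x]
    _ = ∫⁻ y in F, ∫⁻ x, g x * edist y x ^ (-β) ∂U ∂S := by
        have hm' : Measurable fun z : EuclideanSpace ℝ (Fin n) × EuclideanSpace ℝ (Fin n) =>
            g z.1 * edist z.2 z.1 ^ (-β) :=
          (hg.comp measurable_fst).mul ((measurable_snd.edist measurable_fst).pow_const _)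
        exact lintegral_lintegral_swap hm'.aemeasurable
    _ ≤ C₂ * (C₁ * (∫⁻ x, g x ^ q' ∂U) ^ (1 / q')) * S F ^ (1 - 1 / p') :=
        hC₂ S F hF (fun y => ∫⁻ x, g x * edist y x ^ (-β) ∂U) hm
          (C₁ * (∫⁻ x, g x ^ q' ∂U) ^ (1 / q')) (hC₁ g hg hgq)
    _ = _ := by
        have : 1 - 1 / p' = 1 / p := by
          have := hp.inv_add_inv_eq_one
          simp only [one_div]; linarith
        rw [this]; push_cast; ring

theorem measurable_dyadicKernel (β : ℝ) (τ : EuclideanSpace ℝ (Fin n)) :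
    Measurable fun z : EuclideanSpace ℝ (Fin n) × EuclideanSpace ℝ (Fin n) =>
      dyadicKernel β τ z.1 z.2 := by
  refine Measurable.tsum fun i => ?_
  have h1 : Measurable ((dyadicCube τ i).indicator (1 : EuclideanSpace ℝ (Fin n) → ℝ≥0∞)) :=
    measurable_one.indicator (measurableSet_dyadicCube τ i)
  exact ((h1.comp measurable_fst).mul (h1.comp measurable_snd)).const_mul _

/-- Every term of the dyadic kernel is a product in `x` and `y`, so Tonelli turns the form into the
sum treated on laminar families. -/
theorem lintegral_lintegral_dyadicKernel (β : ℝ) (S U : Measure (EuclideanSpace ℝ (Fin n)))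
    (τ : EuclideanSpace ℝ (Fin n)) {f g : EuclideanSpace ℝ (Fin n) → ℝ≥0∞} (hf : Measurable f)
    (hg : Measurable g) :
    ∫⁻ x, ∫⁻ y, g x * (f y * dyadicKernel β τ x y) ∂S ∂U = ∑' i, dyadicWeight β i *
      (∫⁻ y in dyadicCube τ i, f y ∂S) * (∫⁻ x in dyadicCube τ i, g x ∂U) := by
  have hQ := measurableSet_dyadicCube τ
  have h1 : ∀ i, Measurable ((dyadicCube τ i).indicator
      (1 : EuclideanSpace ℝ (Fin n) → ℝ≥0∞)) := fun i => measurable_one.indicator (hQ i)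
  have hind : ∀ i (h : EuclideanSpace ℝ (Fin n) → ℝ≥0∞) x,
      h x * (dyadicCube τ i).indicator 1 x = (dyadicCube τ i).indicator h x := fun i h x => by
    by_cases hx : x ∈ dyadicCube τ i <;> simp [hx]
  have inner : ∀ x, ∫⁻ y, g x * (f y * dyadicKernel β τ x y) ∂S =
      ∑' i, (dyadicWeight β i * ∫⁻ y in dyadicCube τ i, f y ∂S) *
        (dyadicCube τ i).indicator g x := by
    intro x
    have : ∀ y, g x * (f y * dyadicKernel β τ x y) = ∑' i, (dyadicWeight β i *
        (dyadicCube τ i).indicator g x) * (dyadicCube τ i).indicator f y := by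
      intro y
      rw [dyadicKernel, ← ENNReal.tsum_mul_left, ← ENNReal.tsum_mul_left]
      refine tsum_congr fun i => ?_
      rw [← hind i g, ← hind i f]; ring
    simp_rw [this]
    rw [lintegral_tsum fun i => ((hf.indicator (hQ i)).const_mul _).aemeasurable]
    refine tsum_congr fun i => ?_
    rw [lintegral_const_mul _ (hf.indicator (hQ i)), lintegral_indicator (hQ i)]; ring
  simp_rw [inner]
  rw [lintegral_tsum fun i => ((hg.indicator (hQ i)).const_mul _).aemeasurable]
  refine tsum_congr fun i => ?_
  rw [lintegral_const_mul _ (hg.indicator (hQ i)), lintegral_indicator (hQ i)]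

/-- The testing condition for a finite part of the dyadic model of the kernel. -/
theorem exists_dyadic_testing {β p q : ℝ} (hβ : 0 < β) (hq0 : 0 < q)
    (S U : Measure (EuclideanSpace ℝ (Fin n))) [IsLocallyFiniteMeasure S] (hS : ∀ x, S {x} = 0)
    (hT : ∃ C : ℝ≥0, ∀ F : Set (EuclideanSpace ℝ (Fin n)), S F ≠ ∞ →
      (∫⁻ x, (∫⁻ y in F, edist x y ^ (-β) ∂S) ^ q ∂U) ^ (1 / q) ≤ C * S F ^ (1 / p)) :
    ∃ A : ℝ≥0, ∀ (s : Finset (ℤ × (Fin n → ℤ))) (τ : EuclideanSpace ℝ (Fin n)) (j : s),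
      (∫⁻ x, (∑ i : s, {i : s | dyadicCube τ i ⊆ dyadicCube τ j}.indicator
        (fun i => dyadicWeight β i.1 * S (dyadicCube τ i) * (dyadicCube τ i).indicator 1 x) i) ^ q
          ∂U) ^ (1 / q) ≤ A * S (dyadicCube τ j) ^ (1 / p) := by
  obtain ⟨C, hC⟩ := hT
  obtain ⟨C₀, hC₀⟩ := exists_sum_dyadicWeight_le (n := n) hβ
  refine ⟨C₀ * C, fun s τ j => ?_⟩
  have h1 : ∀ i, Measurable ((dyadicCube τ i).indicator
      (1 : EuclideanSpace ℝ (Fin n) → ℝ≥0∞)) := fun i =>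
    measurable_one.indicator (measurableSet_dyadicCube τ i)
  -- Cubes inside `dyadicCube τ j` see only the mass of `S` in it, so their sum is dominated by the
  -- true potential of that cube, uniformly in `s` and `τ`. The diagonal is negligible because `S`
  -- has no atoms.
  have pw : ∀ x, ∑ i : s, {i : s | dyadicCube τ i ⊆ dyadicCube τ j}.indicator
      (fun i => dyadicWeight β i.1 * S (dyadicCube τ i) * (dyadicCube τ i).indicator 1 x) i ≤
      C₀ * ∫⁻ y in dyadicCube τ j, edist x y ^ (-β) ∂S := by
    intro x
    calc _ ≤ ∑ i : s, ∫⁻ y in dyadicCube τ j, dyadicWeight β i.1 *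
          ((dyadicCube τ i).indicator 1 x * (dyadicCube τ i).indicator 1 y) ∂S := by
          refine Finset.sum_le_sum fun i _ => ?_
          by_cases hi : dyadicCube τ i ⊆ dyadicCube τ j
          · rw [Set.indicator_of_mem (by exact hi),
              lintegral_const_mul _ ((h1 i).const_mul _), lintegral_const_mul _ (h1 i),
              lintegral_indicator_one (measurableSet_dyadicCube τ i),
              Measure.restrict_apply (measurableSet_dyadicCube τ i),
              Set.inter_eq_left.2 hi]
            exact le_of_eq (by ring)
          · rw [Set.indicator_of_notMem (by exact hi)]; exact bot_le
      _ = ∫⁻ y in dyadicCube τ j, ∑ i ∈ s, dyadicWeight β i *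
          ((dyadicCube τ i).indicator 1 x * (dyadicCube τ i).indicator 1 y) ∂S := by
          rw [lintegral_finsetSum' _ fun i _ => (((h1 i).const_mul _).const_mul _).aemeasurable]
          exact Finset.sum_coe_sort s (fun i => ∫⁻ y in dyadicCube τ j, dyadicWeight β i *
            ((dyadicCube τ i).indicator 1 x * (dyadicCube τ i).indicator 1 y) ∂S)
      _ ≤ ∫⁻ y in dyadicCube τ j, C₀ * edist x y ^ (-β) ∂S := by
          refine lintegral_mono_ae (ae_restrict_of_ae ?_)
          filter_upwards [compl_mem_ae_iff.2 (hS x)] with y hy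
          exact hC₀ s τ x y fun h => hy (by simp [h])
      _ = _ := lintegral_const_mul _ (measurable_edist_rpow_right β x)
  calc _ ≤ (∫⁻ x, (C₀ * ∫⁻ y in dyadicCube τ j, edist x y ^ (-β) ∂S) ^ q ∂U) ^ (1 / q) := by
        gcongr with x
        exact pw x
    _ = C₀ * (∫⁻ x, (∫⁻ y in dyadicCube τ j, edist x y ^ (-β) ∂S) ^ q ∂U) ^ (1 / q) := by
        simp_rw [ENNReal.mul_rpow_of_nonneg _ _ hq0.le]
        rw [lintegral_const_mul _ ((measurable_edist_rpow β).lintegral_prod_right'.pow_const _),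
          ENNReal.mul_rpow_of_nonneg _ _ (by positivity), ← ENNReal.rpow_mul,
          mul_one_div_cancel hq0.ne', ENNReal.rpow_one]
    _ ≤ C₀ * (C * S (dyadicCube τ j) ^ (1 / p)) := by
        gcongr
        exact hC _ (measure_dyadicCube_ne_top S τ j)
    _ = _ := by push_cast; ring

/-- The off-diagonal strong type inequality for the Riesz kernel from the two testing conditions. -/
theorem exists_strong_type_of_testing {β p p' q q' : ℝ} (hβ : 0 < β) (hp : p.HolderConjugate p')
    (hq : q.HolderConjugate q') (hqp : q' ≤ p') (S U : Measure (EuclideanSpace ℝ (Fin n)))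
    [IsLocallyFiniteMeasure S] [IsLocallyFiniteMeasure U] (hS : ∀ x, S {x} = 0)
    (hU : ∀ x, U {x} = 0)
    (hT : ∃ C : ℝ≥0, ∀ F : Set (EuclideanSpace ℝ (Fin n)), S F ≠ ∞ →
      (∫⁻ x, (∫⁻ y in F, edist x y ^ (-β) ∂S) ^ q ∂U) ^ (1 / q) ≤ C * S F ^ (1 / p))
    (hT' : ∃ C : ℝ≥0, ∀ F : Set (EuclideanSpace ℝ (Fin n)), U F ≠ ∞ →
      (∫⁻ y, (∫⁻ x in F, edist y x ^ (-β) ∂U) ^ p' ∂S) ^ (1 / p') ≤ C * U F ^ (1 / q')) :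
    ∃ C : ℝ≥0, ∀ f : EuclideanSpace ℝ (Fin n) → ℝ≥0∞, Measurable f → ∫⁻ y, f y ^ p ∂S ≠ ∞ →
      (∫⁻ x, (∫⁻ y, f y * edist x y ^ (-β) ∂S) ^ q ∂U) ^ (1 / q) ≤
        C * (∫⁻ y, f y ^ p ∂S) ^ (1 / p) := by
  obtain ⟨A, hA⟩ := exists_dyadic_testing (p := p) hβ hq.pos S U hS hT
  obtain ⟨B, hB⟩ := exists_dyadic_testing (p := q') hβ hp.symm.pos U S hU hT'
  obtain ⟨C, hC⟩ := exists_sum_laminar_le (X := EuclideanSpace ℝ (Fin n)) hp hq hqp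
  have hdy : ∀ (τ : EuclideanSpace ℝ (Fin n)) (f g : EuclideanSpace ℝ (Fin n) → ℝ≥0∞),
      Measurable f → Measurable g → ∫⁻ y, f y ^ p ∂S ≠ ∞ → ∫⁻ x, g x ^ q' ∂U ≠ ∞ →
      ∫⁻ x, ∫⁻ y, g x * (f y * dyadicKernel β τ x y) ∂S ∂U ≤
        C * (A + B) * (∫⁻ y, f y ^ p ∂S) ^ (1 / p) * (∫⁻ x, g x ^ q' ∂U) ^ (1 / q') := by
    intro τ f g hf hg hfp hgq
    rw [lintegral_lintegral_dyadicKernel β S U τ hf hg, ENNReal.tsum_eq_iSup_sum]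
    refine iSup_le fun s => ?_
    rw [← Finset.sum_coe_sort s (fun i => dyadicWeight β i *
      (∫⁻ y in dyadicCube τ i, f y ∂S) * (∫⁻ x in dyadicCube τ i, g x ∂U))]
    have h1 := hC s S U (fun i => dyadicCube τ i.1) (fun i => measurableSet_dyadicCube τ i.1)
      (fun i j => dyadicCube_laminar τ i.1 j.1) (fun i => measure_dyadicCube_ne_top S τ i.1)
      (fun i => measure_dyadicCube_ne_top U τ i.1) (fun i => dyadicWeight β i.1) A B
    exact h1 (fun j => hA s τ j) (fun j => hB s τ j) f g hf hg hfp hgq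
  have h6 : (6 : ℝ≥0∞) ^ β ≠ ∞ := ENNReal.rpow_ne_top_of_nonneg hβ.le (by norm_num)
  refine ⟨(6 ^ β : ℝ≥0∞).toNNReal * 2 ^ n * (C * (A + B)), fun f hf hfp => ?_⟩
  have hpm : Measurable fun x => ∫⁻ y, f y * edist x y ^ (-β) ∂S :=
    Measurable.lintegral_prod_right'
      (f := fun z : EuclideanSpace ℝ (Fin n) × EuclideanSpace ℝ (Fin n) =>
        f z.2 * edist z.1 z.2 ^ (-β)) ((hf.comp measurable_snd).mul (measurable_edist_rpow β))
  refine rpow_lintegral_le_of_forall_lintegral_mul_le U hq hpm fun g hg hgq => ?_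
  set Φ : ℕ → EuclideanSpace ℝ (Fin n) → EuclideanSpace ℝ (Fin n) → ℝ≥0∞ := fun K x y =>
    ∑ t : Fin n → Bool, 6 ^ β * (g x * (f y * dyadicKernel β (gridShift K t) x y)) with hΦ
  have hdm : ∀ K (t : Fin n → Bool), Measurable fun z : EuclideanSpace ℝ (Fin n) ×
      EuclideanSpace ℝ (Fin n) =>
      6 ^ β * (g z.1 * (f z.2 * dyadicKernel β (gridShift K t) z.1 z.2)) := fun K t =>
    ((hg.comp measurable_fst).mul ((hf.comp measurable_snd).mul
      (measurable_dyadicKernel β (gridShift K t)))).const_mul _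
  have hΦm : ∀ K, Measurable fun z : EuclideanSpace ℝ (Fin n) × EuclideanSpace ℝ (Fin n) =>
      Φ K z.1 z.2 := fun K => Finset.measurable_sum _ fun t _ => hdm K t
  have hΦle : ∀ K, ∫⁻ x, ∫⁻ y, Φ K x y ∂S ∂U ≤ 6 ^ β * 2 ^ n * (C * (A + B)) *
      (∫⁻ y, f y ^ p ∂S) ^ (1 / p) * (∫⁻ x, g x ^ q' ∂U) ^ (1 / q') := by
    intro K
    have e1 : ∀ x, ∫⁻ y, Φ K x y ∂S = ∑ t : Fin n → Bool,
        ∫⁻ y, 6 ^ β * (g x * (f y * dyadicKernel β (gridShift K t) x y)) ∂S := fun x =>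
      lintegral_finsetSum' _ fun t _ => ((hdm K t).comp measurable_prodMk_left).aemeasurable
    simp_rw [e1]
    rw [lintegral_finsetSum' _ fun t _ => ((hdm K t).lintegral_prod_right').aemeasurable]
    calc _ ≤ ∑ t : Fin n → Bool, 6 ^ β * (C * (A + B) * (∫⁻ y, f y ^ p ∂S) ^ (1 / p) *
          (∫⁻ x, g x ^ q' ∂U) ^ (1 / q')) := by
          refine Finset.sum_le_sum fun t _ => ?_
          simp_rw [lintegral_const_mul' _ _ h6]
          gcongr
          exact hdy _ f g hf hg hfp hgq
      _ = _ := by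
          rw [Finset.sum_const, nsmul_eq_mul]
          simp only [Finset.card_univ, Fintype.card_pi, Fintype.card_bool, Finset.prod_const,
            Fintype.card_fin]
          push_cast; ring
  calc ∫⁻ x, (∫⁻ y, f y * edist x y ^ (-β) ∂S) * g x ∂U
      = ∫⁻ x, ∫⁻ y, g x * (f y * edist x y ^ (-β)) ∂S ∂U := by
        refine lintegral_congr fun x => ?_
        have hm : Measurable fun y => f y * edist x y ^ (-β) :=
          hf.mul (measurable_edist_rpow_right β x)
        rw [mul_comm, lintegral_const_mul _ hm]
    -- The dyadic bound holds only for `K` large depending on `(x, y)`, while the bound on the forms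
    -- is uniform in `K`; Fatou's lemma, applied twice, bridges the two.
    _ ≤ ∫⁻ x, ∫⁻ y, Filter.liminf (fun K => Φ K x y) Filter.atTop ∂S ∂U := by
        refine lintegral_mono fun x => lintegral_mono_ae ?_
        filter_upwards [compl_mem_ae_iff.2 (hS x)] with y hy
        obtain ⟨K₀, hK₀⟩ := edist_rpow_le_dyadicKernel hβ (fun h : x = y => hy (by simp [h]))
        refine Filter.le_liminf_of_le (by isBoundedDefault) ?_
        filter_upwards [Filter.eventually_ge_atTop K₀] with K hK
        calc g x * (f y * edist x y ^ (-β)) ≤ g x * (f y * (6 ^ β *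
              ∑ t : Fin n → Bool, dyadicKernel β (gridShift K t) x y)) := by
              gcongr
              exact hK₀ K hK
          _ = Φ K x y := by
              simp only [hΦ, Finset.mul_sum]
              refine Finset.sum_congr rfl fun t _ => by ring
    _ ≤ ∫⁻ x, Filter.liminf (fun K => ∫⁻ y, Φ K x y ∂S) Filter.atTop ∂U :=
        lintegral_mono fun x => lintegral_liminf_le fun K => (hΦm K).comp measurable_prodMk_left
    _ ≤ Filter.liminf (fun K => ∫⁻ x, ∫⁻ y, Φ K x y ∂S ∂U) Filter.atTop :=
        lintegral_liminf_le fun K => (hΦm K).lintegral_prod_right'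
    _ ≤ Filter.liminf (fun _ : ℕ => 6 ^ β * 2 ^ n * (C * (A + B)) *
          (∫⁻ y, f y ^ p ∂S) ^ (1 / p) * (∫⁻ x, g x ^ q' ∂U) ^ (1 / q')) Filter.atTop :=
        Filter.liminf_le_liminf (Filter.Eventually.of_forall hΦle)
    _ = _ := by
        rw [Filter.liminf_const]
        push_cast
        rw [ENNReal.coe_toNNReal h6]

end Strong

/-! ### The maximal inequalities and the weighted potential -/

section FractionalIntegral

open Metric Set

variable {n : ℕ}

instance sigmaFinite_weightMeasure (w : EuclideanSpace ℝ (Fin n) → ℝ) :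
    SigmaFinite (weightMeasure w) :=
  SigmaFinite.withDensity_ofReal w

theorem weightMeasure_singleton (hn : 0 < n) (w : EuclideanSpace ℝ (Fin n) → ℝ)
    (x : EuclideanSpace ℝ (Fin n)) : weightMeasure w {x} = 0 := by
  have : Nonempty (Fin n) := ⟨⟨0, hn⟩⟩
  exact withDensity_absolutelyContinuous _ _ (measure_singleton x)

/-- Positivity of a weight on a set of positive measure is used through this fact alone: it keeps
the kernel norm `ψ` in `exists_global_testing` from vanishing. -/
theorem weightMeasure_ne_zero {w : EuclideanSpace ℝ (Fin n) → ℝ} (hw : IsWeight w) :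
    weightMeasure w ≠ 0 := by
  intro h
  have h1 := (withDensity_eq_zero_iff hw.aemeasurable.ennreal_ofReal).1 h
  refine hw.pos.ne' ?_
  refine measure_mono_null (fun x hx => ?_) h1
  simpa using hx

theorem measurableSet_cube (a : EuclideanSpace ℝ (Fin n)) (l : ℝ) : MeasurableSet (cube a l) := by
  have : cube a l = ⋂ i, {y : EuclideanSpace ℝ (Fin n) | a i ≤ y i ∧ y i < a i + l} := by
    ext y; simp [cube]
  rw [this]
  refine MeasurableSet.iInter fun i => ?_
  have hm : Measurable fun y : EuclideanSpace ℝ (Fin n) => y i := by fun_prop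
  exact (measurableSet_le measurable_const hm).inter (measurableSet_lt hm measurable_const)

theorem volume_cube (a : EuclideanSpace ℝ (Fin n)) (l : ℝ) :
    volume (cube a l) = ENNReal.ofReal l ^ n := by
  have h := (PiLp.volume_preserving_toLp (Fin n)).measure_preimage
    (measurableSet_cube a l).nullMeasurableSet
  have e : (WithLp.toLp 2 : (Fin n → ℝ) → EuclideanSpace ℝ (Fin n)) ⁻¹' cube a l =
      Set.pi Set.univ fun i => Set.Ico (a i) (a i + l) := by
    ext y; simp [cube, Set.mem_pi]
  rw [← h, e, Real.volume_pi_Ico]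
  simp

/-- Lower bound for the maximal function of a set contained in a ball. -/
theorem le_fracMaximal_indicator {α : ℝ} (hn : 0 < n)
    (u : EuclideanSpace ℝ (Fin n) → ℝ)
    {x : EuclideanSpace ℝ (Fin n)} {r : ℝ} (hr : 0 < r) {F : Set (EuclideanSpace ℝ (Fin n))}
    (hF : MeasurableSet F) (hFx : F ⊆ closedBall x r) (y : EuclideanSpace ℝ (Fin n)) :
    ENNReal.ofReal (4 * (r + dist x y)) ^ (-((n : ℝ) - α)) * weightMeasure u F ≤
      fracMaximal α (fun z => F.indicator (fun _ => (1 : ℝ)) z * u z) y := by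
  -- `cube a (2 * L)` is centred at `x`. Its half-side is twice `r + dist x y`, so the half-open
  -- cube contains `y` and `F` with room to spare.
  set L : ℝ := 2 * (r + dist x y) with hL
  have hd : 0 ≤ dist x y := dist_nonneg
  have hL0 : 0 < L := by positivity
  have hn' : (0 : ℝ) < n := by exact_mod_cast hn
  set a : EuclideanSpace ℝ (Fin n) := WithLp.toLp 2 fun i => x i - L with ha
  have hcube : ∀ z, dist x z ≤ r + dist x y → z ∈ cube a (2 * L) := by
    intro z hz i
    have h1 : |x i - z i| ≤ r + dist x y := by
      refine le_trans ?_ hz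
      simpa [Real.dist_eq] using PiLp.dist_apply_le x z i
    have h2 := abs_le.1 h1
    simp only [ha]
    constructor <;> linarith
  have hy : y ∈ cube a (2 * L) := hcube y (by linarith)
  have hFc : F ⊆ cube a (2 * L) := fun z hz => hcube z (by
    have := hFx hz
    rw [mem_closedBall, dist_comm] at this
    linarith)
  have hint : weightMeasure u F ≤ ∫⁻ z in cube a (2 * L),
      ‖F.indicator (fun _ => (1 : ℝ)) z * u z‖ₑ := by
    calc weightMeasure u F = ∫⁻ z in F, ENNReal.ofReal (u z) := withDensity_apply _ hF
      _ ≤ ∫⁻ z in F, ‖F.indicator (fun _ => (1 : ℝ)) z * u z‖ₑ := by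
          refine setLIntegral_mono' hF fun z hz => ?_
          rw [indicator_of_mem hz, one_mul]
          exact Real.ofReal_le_enorm _
      _ ≤ _ := lintegral_mono_set hFc
  have hvol : ENNReal.ofReal (4 * (r + dist x y)) ^ (-((n : ℝ) - α)) =
      volume (cube a (2 * L)) ^ (α / n) * (volume (cube a (2 * L)))⁻¹ := by
    have hl : 4 * (r + dist x y) = 2 * L := by rw [hL]; ring
    have h0 : ENNReal.ofReal (2 * L) ≠ 0 := by simpa using hL0
    rw [volume_cube, hl]
    rw [← ENNReal.rpow_natCast, ← ENNReal.rpow_mul, ← ENNReal.rpow_neg,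
      ← ENNReal.rpow_add _ _ h0 ENNReal.ofReal_ne_top]
    congr 1
    field_simp
    ring
  calc _ ≤ volume (cube a (2 * L)) ^ (α / n) * ((volume (cube a (2 * L)))⁻¹ *
        ∫⁻ z in cube a (2 * L), ‖F.indicator (fun _ => (1 : ℝ)) z * u z‖ₑ) := by
        rw [hvol, mul_assoc]
        gcongr
    _ ≤ _ := by
        refine le_iSup_of_le a (le_iSup_of_le (2 * L) ?_)
        exact le_iSup_of_le (by positivity) (le_iSup_of_le hy le_rfl)

theorem eLpNorm_ofReal_eq {X ε : Type*} [MeasurableSpace X] [ENorm ε] (μ : Measure X) (f : X → ε)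
    {p : ℝ} (hp : 0 < p) :
    eLpNorm f (ENNReal.ofReal p) μ = (∫⁻ x, ‖f x‖ₑ ^ p ∂μ) ^ (1 / p) := by
  rw [eLpNorm_eq_lintegral_rpow_enorm_toReal (by simpa using hp) ENNReal.ofReal_ne_top,
    ENNReal.toReal_ofReal hp.le]

/-- The maximal inequality, tested on subsets of balls. -/
theorem exists_global_testing {α p p' q q' : ℝ} (hαn : α < n) (hn : 0 < n)
    (hp : p.HolderConjugate p') (hq : q.HolderConjugate q')
    {u σ : EuclideanSpace ℝ (Fin n) → ℝ} (hσ : IsWeight σ)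
    (hM : StrongType (fracMaximal α) q' p' u σ) :
    ∃ A : ℝ≥0∞, A ≠ ∞ ∧ ∀ (x : EuclideanSpace ℝ (Fin n)) (r : ℝ), 0 < r →
      weightMeasure u (closedBall x r) ≠ ∞ ∧
      (∫⁻ y in (ball x r)ᶜ, (edist x y ^ (-((n : ℝ) - α))) ^ p' ∂(weightMeasure σ)) ^ (1 / p') *
        weightMeasure u (closedBall x r) ^ (1 / q) ≤ A := by
  obtain ⟨C, hC⟩ := hM
  set β : ℝ := (n : ℝ) - α with hβ
  have hβ0 : 0 < β := sub_pos.2 hαn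
  have hp0' := hp.symm.pos
  have hq0' := hq.symm.pos
  have hq0 := hq.pos
  have h8 : ENNReal.ofReal 8 ^ β ≠ ∞ := ENNReal.rpow_ne_top_of_nonneg hβ0.le ENNReal.ofReal_ne_top
  refine ⟨ENNReal.ofReal 8 ^ β * C, ENNReal.mul_ne_top h8 ENNReal.coe_ne_top, fun x r hr => ?_⟩
  set S := weightMeasure σ with hS
  set U := weightMeasure u with hU
  set k : EuclideanSpace ℝ (Fin n) → ℝ≥0∞ := fun y =>
    ENNReal.ofReal (4 * (r + dist x y)) ^ (-β) with hk
  have hkm : Measurable k := by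
    refine Measurable.pow_const (Measurable.ennreal_ofReal ?_) _
    exact ((measurable_const.dist measurable_id).const_add r).const_mul 4
  set ψ : ℝ≥0∞ := (∫⁻ y, k y ^ p' ∂S) ^ (1 / p') with hψ
  have hk0 : ∀ y, k y ≠ 0 := fun y => by
    simp only [hk, ne_eq, ENNReal.rpow_eq_zero_iff, not_or, not_and]
    exact ⟨fun _ h => absurd h (by linarith), fun h => absurd h ENNReal.ofReal_ne_top⟩
  have hψ0 : ψ ≠ 0 := by
    intro h
    rw [hψ, ENNReal.rpow_eq_zero_iff] at h
    have hI : ∫⁻ y, k y ^ p' ∂S = 0 := by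
      rcases h with h | h
      · exact h.1
      · have : 0 < 1 / p' := by positivity
        exact absurd h.2 (not_lt.2 this.le)
    rw [lintegral_eq_zero_iff (hkm.pow_const _)] at hI
    refine weightMeasure_ne_zero hσ ?_
    rw [← hS, ← Measure.measure_univ_eq_zero]
    refine measure_mono_null (fun y _ => ?_) hI
    simp [ENNReal.rpow_eq_zero_iff, hk0 y, hp0', hp0'.not_gt]
  -- The maximal inequality for the indicator of `F`, divided by `U F ^ (1 / q')`. The division
  -- needs `U F` finite, and local finiteness of `U` is not yet known.
  have htest : ∀ F : Set (EuclideanSpace ℝ (Fin n)), MeasurableSet F → F ⊆ closedBall x r →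
      U F ≠ ∞ → ψ * U F ^ (1 / q) ≤ C := by
    intro F hF hFx hUF
    rcases eq_or_ne (U F) 0 with h0 | h0
    · rw [h0, ENNReal.zero_rpow_of_pos (by positivity), mul_zero]; exact bot_le
    have h1 := hC (F.indicator fun _ => (1 : ℝ)) (memLp_indicator_const _ hF _ (Or.inr hUF))
    rw [eLpNorm_indicator_const hF (by simpa using hq0') ENNReal.ofReal_ne_top,
      eLpNorm_ofReal_eq _ _ hp0', ENNReal.toReal_ofReal hq0'.le] at h1
    simp only [enorm_one, one_mul, enorm_eq_self] at h1
    have h2 : ψ * U F ≤ C * U F ^ (1 / q') := by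
      refine le_trans ?_ h1
      have e : ψ * U F = (∫⁻ y, (k y * U F) ^ p' ∂S) ^ (1 / p') := by
        simp_rw [ENNReal.mul_rpow_of_nonneg _ _ hp0'.le]
        rw [lintegral_mul_const _ (hkm.pow_const _), ENNReal.mul_rpow_of_nonneg _ _ (by positivity),
          ← ENNReal.rpow_mul, mul_one_div_cancel hp0'.ne', ENNReal.rpow_one]
      rw [e]
      gcongr with y
      exact le_fracMaximal_indicator hn u hr hF hFx y
    have h3 : U F ^ (1 / q') ≠ 0 := by simp [ENNReal.rpow_eq_zero_iff, h0, hUF]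
    have h4 : U F ^ (1 / q') ≠ ∞ := by simp [ENNReal.rpow_eq_top_iff, h0, hUF]
    rw [← ENNReal.mul_le_mul_iff_left h3 h4]
    refine le_trans (le_of_eq ?_) h2
    rw [mul_assoc, ← ENNReal.rpow_add _ _ h0 hUF]
    have := hq.inv_add_inv_eq_one
    rw [show 1 / q + 1 / q' = 1 by simpa [one_div] using this, ENNReal.rpow_one]
  have hCψ : ((C : ℝ≥0∞) / ψ) ≠ ∞ := ENNReal.div_ne_top ENNReal.coe_ne_top hψ0
  -- Exhausting the ball by sets of finite `U`-mass yields a uniform bound, since `ψ ≠ 0`; this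
  -- proves local finiteness.
  have hUle : U (closedBall x r) ≤ ((C : ℝ≥0∞) / ψ) ^ q := by
    have hmono : Monotone fun k => closedBall x r ∩ spanningSets U k := fun i j hij =>
      inter_subset_inter_right _ (monotone_spanningSets U hij)
    have : closedBall x r = ⋃ k, closedBall x r ∩ spanningSets U k := by
      rw [← inter_iUnion, iUnion_spanningSets, inter_univ]
    rw [this, hmono.measure_iUnion]
    refine iSup_le fun k => ?_
    have hfin : U (closedBall x r ∩ spanningSets U k) ≠ ∞ :=
      ne_top_of_le_ne_top (measure_spanningSets_lt_top U k).ne (measure_mono inter_subset_right)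
    have h := htest _ (isClosed_closedBall.measurableSet.inter (measurableSet_spanningSets U k))
      inter_subset_left hfin
    have h' : U (closedBall x r ∩ spanningSets U k) ^ (1 / q) ≤ (C : ℝ≥0∞) / ψ := by
      rw [ENNReal.le_div_iff_mul_le (Or.inl hψ0) (Or.inr ENNReal.coe_ne_top), mul_comm]
      exact h
    have h'' := ENNReal.rpow_le_rpow h' hq0.le
    rwa [← ENNReal.rpow_mul, one_div_mul_cancel hq0.ne', ENNReal.rpow_one] at h''
  have hUt : U (closedBall x r) ≠ ∞ :=
    ne_top_of_le_ne_top (ENNReal.rpow_ne_top_of_nonneg hq0.le hCψ) hUle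
  refine ⟨hUt, ?_⟩
  have hfull := htest _ isClosed_closedBall.measurableSet subset_rfl hUt
  -- Off the ball `r ≤ dist x y`, so `4 * (r + dist x y) ≤ 8 * dist x y`, whence the factor `8 ^ β`.
  have hker : ∀ y ∈ (ball x r)ᶜ, edist x y ^ (-β) ≤ ENNReal.ofReal 8 ^ β * k y := by
    intro y hy
    have hry : r ≤ dist x y := by
      rw [dist_comm]; simpa using hy
    have h1 : ENNReal.ofReal (4 * (r + dist x y)) ≤ ENNReal.ofReal 8 * edist x y := by
      rw [edist_dist, ← ENNReal.ofReal_mul (by norm_num)]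
      exact ENNReal.ofReal_le_ofReal (by linarith)
    have h2 : (ENNReal.ofReal 8 * edist x y) ^ (-β) ≤ k y := by
      simp only [hk]
      rw [ENNReal.rpow_neg, ENNReal.rpow_neg]
      exact ENNReal.inv_le_inv.2 (ENNReal.rpow_le_rpow h1 hβ0.le)
    calc edist x y ^ (-β) = ENNReal.ofReal 8 ^ β * (ENNReal.ofReal 8 * edist x y) ^ (-β) := by
          rw [ENNReal.mul_rpow_of_ne_top ENNReal.ofReal_ne_top (edist_ne_top _ _), ← mul_assoc,
            ← ENNReal.rpow_add _ _ (by simp) ENNReal.ofReal_ne_top, add_neg_cancel,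
            ENNReal.rpow_zero, one_mul]
      _ ≤ _ := by gcongr
  calc (∫⁻ y in (ball x r)ᶜ, (edist x y ^ (-β)) ^ p' ∂S) ^ (1 / p') * U (closedBall x r) ^ (1 / q)
      ≤ (∫⁻ y, (ENNReal.ofReal 8 ^ β * k y) ^ p' ∂S) ^ (1 / p') *
          U (closedBall x r) ^ (1 / q) := by
        refine mul_le_mul' (ENNReal.rpow_le_rpow ?_ (by positivity)) le_rfl
        refine (setLIntegral_mono' measurableSet_ball.compl fun y hy => ?_).trans
          (setLIntegral_le_lintegral _ _)
        exact ENNReal.rpow_le_rpow (hker y hy) hp0'.le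
    _ = ENNReal.ofReal 8 ^ β * (ψ * U (closedBall x r) ^ (1 / q)) := by
        simp_rw [ENNReal.mul_rpow_of_nonneg _ _ hp0'.le]
        rw [lintegral_const_mul _ (hkm.pow_const _), ENNReal.mul_rpow_of_nonneg _ _ (by positivity),
          ← ENNReal.rpow_mul (ENNReal.ofReal 8 ^ β), mul_one_div_cancel hp0'.ne',
          ENNReal.rpow_one, mul_assoc]
    _ ≤ _ := by gcongr

theorem isLocallyFiniteMeasure_of_maximal {α p p' q q' : ℝ} (hαn : α < n) (hn : 0 < n)
    (hp : p.HolderConjugate p') (hq : q.HolderConjugate q')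
    {u σ : EuclideanSpace ℝ (Fin n) → ℝ} (hσ : IsWeight σ)
    (hM : StrongType (fracMaximal α) q' p' u σ) : IsLocallyFiniteMeasure (weightMeasure u) := by
  obtain ⟨A, -, hA⟩ := exists_global_testing hαn hn hp hq hσ hM
  exact ⟨fun x => ⟨closedBall x 1, closedBall_mem_nhds x one_pos,
    (hA x 1 one_pos).1.lt_top⟩⟩

/-- The maximal inequality of the dual pair gives the weak type inequality for the potential. -/
theorem exists_potential_weak_type {α p p' q q' : ℝ} (hαn : α < n) (hn : 0 < n)
    (hp : p.HolderConjugate p') (hq : q.HolderConjugate q') (hpq : p < q)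
    {u σ : EuclideanSpace ℝ (Fin n) → ℝ} (hσ : IsWeight σ)
    (hM : StrongType (fracMaximal α) q' p' u σ) :
    ∃ C : ℝ≥0, ∀ f : EuclideanSpace ℝ (Fin n) → ℝ≥0∞, Measurable f →
      ∫⁻ x, f x ^ p ∂(weightMeasure σ) ≠ ∞ → ∀ t : ℝ≥0∞, t ≠ 0 → t ≠ ∞ →
        t * weightMeasure u
          {x | t < ∫⁻ y, f y * edist x y ^ (-((n : ℝ) - α)) ∂(weightMeasure σ)} ^ (1 / q) ≤
          C * (∫⁻ x, f x ^ p ∂(weightMeasure σ)) ^ (1 / p) := by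
  have := isLocallyFiniteMeasure_of_maximal hαn hn hp hq hσ hM
  obtain ⟨A, hAt, hA⟩ := exists_global_testing hαn hn hp hq hσ hM
  exact exists_kernel_weak_type hp hpq (weightMeasure σ) (weightMeasure u)
    (weightMeasure_singleton hn σ) (weightMeasure_singleton hn u)
    (k := fun x y => edist x y ^ (-((n : ℝ) - α)))
    (fun x => measurable_edist_rpow_right _ x) hAt fun x r hr => (hA x r hr).2

/-- The two maximal inequalities give the strong type inequality for the potential. -/
theorem exists_potential_strong_type {α p p' q q' : ℝ} (hαn : α < n) (hn : 0 < n)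
    (hp : p.HolderConjugate p') (hq : q.HolderConjugate q') (hpq : p < q)
    {u σ : EuclideanSpace ℝ (Fin n) → ℝ} (hu : IsWeight u) (hσ : IsWeight σ)
    (hM : StrongType (fracMaximal α) p q σ u) (hM' : StrongType (fracMaximal α) q' p' u σ) :
    ∃ C : ℝ≥0, ∀ f : EuclideanSpace ℝ (Fin n) → ℝ≥0∞, Measurable f →
      ∫⁻ x, f x ^ p ∂(weightMeasure σ) ≠ ∞ →
        (∫⁻ x, (∫⁻ y, f y * edist x y ^ (-((n : ℝ) - α)) ∂(weightMeasure σ)) ^ q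
          ∂(weightMeasure u)) ^ (1 / q) ≤
          C * (∫⁻ x, f x ^ p ∂(weightMeasure σ)) ^ (1 / p) := by
  have hqp : q' < p' := by
    have h1 := hp.inv_add_inv_eq_one
    have h2 := hq.inv_add_inv_eq_one
    have h3 : q⁻¹ < p⁻¹ := inv_strictAnti₀ hp.pos hpq
    exact (inv_lt_inv₀ hp.symm.pos hq.symm.pos).1 (by linarith)
  have := isLocallyFiniteMeasure_of_maximal hαn hn hp hq hσ hM'
  have := isLocallyFiniteMeasure_of_maximal hαn hn hq.symm hp.symm hu hM
  refine exists_strong_type_of_testing (sub_pos.2 hαn) hp hq hqp.le (weightMeasure σ)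
    (weightMeasure u) (weightMeasure_singleton hn σ) (weightMeasure_singleton hn u) ?_ ?_
  -- Testing the potential of `σ` uses the weak inequality for the potential of `u`, which comes
  -- from `hM` with the pair and exponents exchanged.
  · exact exists_testing_of_dual_weak_type hp hq _ _
      (exists_potential_weak_type hαn hn hq.symm hp.symm hqp hu hM)
  · exact exists_testing_of_dual_weak_type hq.symm hp.symm _ _
      (exists_potential_weak_type hαn hn hp hq hpq hσ hM')

/-! ### Passage to the Bochner integral -/

/-- `f` may be arbitrary where `w` vanishes, but the product is zero there. -/
theorem aemeasurable_mul_weight {w f : EuclideanSpace ℝ (Fin n) → ℝ} (hw : IsWeight w)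
    (hf : AEMeasurable f (weightMeasure w)) :
    AEMeasurable (fun y => f y * w y) volume := by
  refine ⟨fun y => hf.mk f y * hw.aemeasurable.mk w y,
    hf.measurable_mk.mul hw.aemeasurable.measurable_mk, ?_⟩
  have h := (ae_withDensity_iff' hw.aemeasurable.ennreal_ofReal).1 hf.ae_eq_mk
  filter_upwards [h, hw.aemeasurable.ae_eq_mk] with y hy hwy
  rw [← hwy]
  rcases (hw.nonneg y).eq_or_lt with h0 | h0
  · rw [← h0, mul_zero, mul_zero]
  · rw [hy (by simpa using h0)]

theorem aemeasurable_rieszIntegrand {w f : EuclideanSpace ℝ (Fin n) → ℝ} (hw : IsWeight w)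
    (hf : AEMeasurable f (weightMeasure w)) (α : ℝ) (x : EuclideanSpace ℝ (Fin n)) :
    AEMeasurable (rieszIntegrand α (fun y => f y * w y) x) volume := by
  refine (aemeasurable_mul_weight hw hf).div (Measurable.aemeasurable ?_)
  exact (measurable_norm.comp (measurable_const.sub measurable_id)).pow_const _

/-- Only an inequality: at `x = y` the real quotient is `0` by the convention for division by zero,
whereas the extended kernel is infinite. -/
theorem enorm_div_norm_rpow_le {β : ℝ} (hβ : 0 < β) (a : ℝ) (x y : EuclideanSpace ℝ (Fin n)) :
    ‖a / ‖x - y‖ ^ β‖ₑ ≤ ‖a‖ₑ * edist x y ^ (-β) := by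
  rcases eq_or_ne x y with rfl | hxy
  · simp [Real.zero_rpow hβ.ne']
  · have hd : 0 < ‖x - y‖ := norm_pos_iff.2 (sub_ne_zero.2 hxy)
    rw [div_eq_mul_inv, enorm_mul, ← Real.rpow_neg hd.le, Real.enorm_of_nonneg (Real.rpow_nonneg hd.le _),
      edist_dist, dist_eq_norm, ENNReal.ofReal_rpow_of_pos hd]

theorem lintegral_enorm_rieszIntegrand_le {α : ℝ} (hαn : α < n)
    {w f : EuclideanSpace ℝ (Fin n) → ℝ} (hw : IsWeight w) (hf : AEMeasurable f (weightMeasure w))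
    (x : EuclideanSpace ℝ (Fin n)) :
    ∫⁻ y, ‖rieszIntegrand α (fun y => f y * w y) x y‖ₑ ≤
      ∫⁻ y, ‖hf.mk f y‖ₑ * edist x y ^ (-((n : ℝ) - α)) ∂(weightMeasure w) := by
  have hm : Measurable fun y => ‖hf.mk f y‖ₑ * edist x y ^ (-((n : ℝ) - α)) :=
    hf.measurable_mk.enorm.mul (measurable_edist_rpow_right _ x)
  refine le_trans (lintegral_mono_ae ?_) (lintegral_withDensity_eq_lintegral_mul₀
    hw.aemeasurable.ennreal_ofReal hm.aemeasurable).ge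
  have h := (ae_withDensity_iff' hw.aemeasurable.ennreal_ofReal).1 hf.ae_eq_mk
  filter_upwards [h] with y hy
  refine (enorm_div_norm_rpow_le (sub_pos.2 hαn) _ x y).trans ?_
  rcases (hw.nonneg y).eq_or_lt with h0 | h0
  · simp [← h0]
  · simp only [Pi.mul_apply]
    rw [← hy (by simpa using h0), enorm_mul, Real.enorm_of_nonneg h0.le]
    exact le_of_eq (by ring)

theorem lintegral_enorm_mk_rpow {μ : Measure (EuclideanSpace ℝ (Fin n))}
    {f : EuclideanSpace ℝ (Fin n) → ℝ} (hf : AEMeasurable f μ) (p : ℝ) :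
    ∫⁻ y, ‖hf.mk f y‖ₑ ^ p ∂μ = ∫⁻ y, ‖f y‖ₑ ^ p ∂μ :=
  lintegral_congr_ae (by filter_upwards [hf.ae_eq_mk] with y hy; rw [hy])

theorem lintegral_enorm_rpow_ne_top {μ : Measure (EuclideanSpace ℝ (Fin n))}
    {f : EuclideanSpace ℝ (Fin n) → ℝ} {p : ℝ} (hp : 0 < p) (hf : MemLp f (ENNReal.ofReal p) μ) :
    ∫⁻ y, ‖f y‖ₑ ^ p ∂μ ≠ ∞ := by
  have h := hf.eLpNorm_ne_top
  rw [eLpNorm_ofReal_eq μ f hp] at h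
  intro h'
  rw [h', ENNReal.top_rpow_of_pos (by positivity)] at h
  exact h rfl

/-- The set where `g = ∞` lies in every superlevel set, so `t * a ≤ B` for all finite nonzero `t`,
impossible for large `t` unless `a = 0`. -/
theorem measure_eq_top_of_weak_bound {X : Type*} [MeasurableSpace X] {μ : Measure X}
    {g : X → ℝ≥0∞} {q : ℝ} (hq : 0 < q) {B : ℝ≥0∞} (hB : B ≠ ∞)
    (h : ∀ t : ℝ≥0∞, t ≠ 0 → t ≠ ∞ → t * μ {x | t < g x} ^ (1 / q) ≤ B) :
    μ {x | g x = ∞} = 0 := by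
  by_contra hne
  set a := μ {x | g x = ∞} ^ (1 / q) with ha
  have ha0 : a ≠ 0 := by
    rw [ha, ne_eq, ENNReal.rpow_eq_zero_iff_of_pos (by positivity)]
    exact hne
  have hb : (B + 1) / a ≠ ∞ := ENNReal.div_ne_top (by simp [hB]) ha0
  have key : ∀ t : ℝ≥0∞, t ≠ 0 → t ≠ ∞ → t * a ≤ B := fun t h0 ht => by
    refine le_trans ?_ (h t h0 ht)
    have hq0 : 0 ≤ 1 / q := by positivity
    refine mul_le_mul' le_rfl (ENNReal.rpow_le_rpow (measure_mono fun x hx => ?_) hq0)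
    have hx' : g x = ∞ := hx
    change t < g x
    rw [hx']
    exact ht.lt_top
  have hat : a ≠ ∞ := ne_top_of_le_ne_top hB (by simpa using key 1 one_ne_zero ENNReal.one_ne_top)
  have h1 := key ((B + 1) / a) (by simp [ENNReal.div_eq_zero_iff, hat]) hb
  rw [ENNReal.div_mul_cancel ha0 hat] at h1
  exact absurd h1 (not_le.2 (ENNReal.lt_add_right hB one_ne_zero))

/-- The weak bound is proved for the integral of the absolute value. It forces that integral to be
finite `u`-almost everywhere, which is convergence, and it dominates `fracIntegral` even at points
where the latter takes the default value `0`. -/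
theorem fracIntegralConverges_and_weakType {α p p' q q' : ℝ} (hαn : α < n) (hn : 0 < n)
    (hp : p.HolderConjugate p') (hq : q.HolderConjugate q') (hpq : p < q)
    {u σ : EuclideanSpace ℝ (Fin n) → ℝ} (hσ : IsWeight σ)
    (hM : StrongType (fracMaximal α) q' p' u σ) :
    FracIntegralConverges α p σ u ∧ WeakType (fracIntegral α) p q σ u := by
  obtain ⟨C, hC⟩ := exists_potential_weak_type hαn hn hp hq hpq hσ hM
  have hbound : ∀ f : EuclideanSpace ℝ (Fin n) → ℝ,
      ∀ hf : MemLp f (ENNReal.ofReal p) (weightMeasure σ), ∀ t : ℝ≥0∞, t ≠ 0 → t ≠ ∞ →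
      t * weightMeasure u {x | t < ∫⁻ y, ‖rieszIntegrand α (fun y => f y * σ y) x y‖ₑ} ^ (1 / q) ≤
        C * eLpNorm f (ENNReal.ofReal p) (weightMeasure σ) := by
    intro f hf t ht0 ht
    have hfm := hf.aestronglyMeasurable.aemeasurable
    have h := hC (fun y => ‖hfm.mk f y‖ₑ) hfm.measurable_mk.enorm
      (by rw [lintegral_enorm_mk_rpow hfm]; exact lintegral_enorm_rpow_ne_top hp.pos hf) t ht0 ht
    rw [lintegral_enorm_mk_rpow hfm, ← eLpNorm_ofReal_eq _ f hp.pos] at h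
    refine le_trans ?_ h
    have hq0 : 0 ≤ 1 / q := one_div_nonneg.2 hq.pos.le
    refine mul_le_mul' le_rfl (ENNReal.rpow_le_rpow (measure_mono fun x hx => ?_) hq0)
    exact lt_of_lt_of_le hx (lintegral_enorm_rieszIntegrand_le hαn hσ hfm x)
  refine ⟨fun f hf => ?_, C, fun f hf t ht => ?_⟩
  · have h0 := measure_eq_top_of_weak_bound hq.pos
      (ENNReal.mul_ne_top ENNReal.coe_ne_top hf.eLpNorm_ne_top) (hbound f hf)
    have h1 : ∀ᵐ x ∂(weightMeasure u),
        ¬ ∫⁻ y, ‖rieszIntegrand α (fun y => f y * σ y) x y‖ₑ = ∞ := by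
      rw [ae_iff]; simpa using h0
    filter_upwards [h1] with x hx
    exact ⟨(aemeasurable_rieszIntegrand hσ hf.aestronglyMeasurable.aemeasurable α
      x).aestronglyMeasurable, lt_top_iff_ne_top.2 hx⟩
  · refine le_trans ?_ (hbound f hf (ENNReal.ofReal t) (by simpa using ht) ENNReal.ofReal_ne_top)
    have hq0 : 0 ≤ 1 / q := one_div_nonneg.2 hq.pos.le
    refine mul_le_mul' le_rfl (ENNReal.rpow_le_rpow (measure_mono fun x hx => ?_) hq0)
    exact lt_of_lt_of_le hx (enorm_integral_le_lintegral_enorm _)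

theorem fracIntegral_strongType {α p p' q q' : ℝ} (hαn : α < n) (hn : 0 < n)
    (hp : p.HolderConjugate p') (hq : q.HolderConjugate q') (hpq : p < q)
    {u σ : EuclideanSpace ℝ (Fin n) → ℝ} (hu : IsWeight u) (hσ : IsWeight σ)
    (hM : StrongType (fracMaximal α) p q σ u) (hM' : StrongType (fracMaximal α) q' p' u σ) :
    StrongType (fracIntegral α) p q σ u := by
  obtain ⟨C, hC⟩ := exists_potential_strong_type hαn hn hp hq hpq hu hσ hM hM'
  refine ⟨C, fun f hf => ?_⟩
  have hfm := hf.aestronglyMeasurable.aemeasurable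
  have h := hC (fun y => ‖hfm.mk f y‖ₑ) hfm.measurable_mk.enorm
    (by rw [lintegral_enorm_mk_rpow hfm]; exact lintegral_enorm_rpow_ne_top hp.pos hf)
  rw [lintegral_enorm_mk_rpow hfm, ← eLpNorm_ofReal_eq _ f hp.pos] at h
  refine le_trans ?_ h
  rw [eLpNorm_ofReal_eq _ _ hq.pos]
  have hq0 : 0 ≤ 1 / q := one_div_nonneg.2 hq.pos.le
  refine ENNReal.rpow_le_rpow (lintegral_mono fun x => ENNReal.rpow_le_rpow ?_ hq.pos.le) hq0
  exact (enorm_integral_le_lintegral_enorm _).trans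
    (lintegral_enorm_rieszIntegrand_le hαn hσ hfm x)

end FractionalIntegral

theorem mainTheorem6 (n : ℕ) (α p q : ℝ) (hα : 0 < α) (hαn : α < n) (hp : 1 < p) (hpq : p < q)
    (u σ : EuclideanSpace ℝ (Fin n) → ℝ) (hu : IsWeight u) (hσ : IsWeight σ) :
    (StrongType (fracMaximal α) p q σ u →
      StrongType (fracMaximal α) (Real.conjExponent q) (Real.conjExponent p) u σ →
        FracIntegralConverges α p σ u ∧ StrongType (fracIntegral α) p q σ u) ∧
    (StrongType (fracMaximal α) (Real.conjExponent q) (Real.conjExponent p) u σ →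
        FracIntegralConverges α p σ u ∧ WeakType (fracIntegral α) p q σ u) := by
  have hn : 0 < n := by exact_mod_cast hα.trans hαn
  have hp' := Real.HolderConjugate.conjExponent hp
  have hq' := Real.HolderConjugate.conjExponent (hp.trans hpq)
  exact ⟨fun h1 h2 => ⟨(fracIntegralConverges_and_weakType hαn hn hp' hq' hpq hσ h2).1,
    fracIntegral_strongType hαn hn hp' hq' hpq hu hσ h1 h2⟩,
    fun h2 => fracIntegralConverges_and_weakType hαn hn hp' hq' hpq hσ h2⟩
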